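/- **Problems.** Let $o\in\{\text{directed},\text{undirected}\}$. An instance consists of an integer $k\ge 1$, a finite digraph $D=(V,A)$ (resp. a finite undirected graph $G=(V,E)$; write $A=E$ in this case), parallel arcs or edges being allowed, color classes $A_1,\dots,A_k$ with $A=A_1\cup\dots\cup A_k$, two distinct vertices $s,t\in V$, and a cost function $c\colon A\to\mathbb R$ that is conservative, i.e. without directed cycles of negative cost (resp. that is nonnegative). A set $A'\subseteq A$ is *feasible* if $A'\cap A_i$ contains (the arc set of) an $s$-$t$ dipath (resp. $s$-$t$ path) for every $i\in\{1,\dots,k\}$. Superset-Simultaneous-Dipaths (resp. Superset-Simultaneous-Paths) asks for a feasible set of minimum cost $\sum_{a\in A'}c(a)$, or for the answer that there is no feasible set. An arc or edge is *multi-colored* if it lies in at least two of the classes; let $F$ be the set of these and $\ell=|F|$. Let $N=|V|+|A|+k$ be the input size. For $\widetilde F\subseteq F$ let $c_{\widetilde F}(a)=0$ if $a\in\widetilde F$ and $c_{\widetilde F}(a)=\max\{c(a),0\}$ otherwise. **Machine model.** A program with random access memory holding arrays of natural numbers and arrays of real numbers; each assignment, test and subroutine call counts as one step. Naturals may be added,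 subtracted (truncated at $0$), compared and used as addresses; reals may be added, subtracted and compared. A program may have another program as a subroutine; the steps of the subroutine are counted. A *shortest path algorithm* is a program that, for every graph of the given kind, every subgraph of it, every two vertices, and all costs that are nonnegative on the subgraph, finds the arc set of a shortest path in the subgraph between the two vertices or reports that there is none, and that leaves the memory reserved for the calling program unchanged. **Theorem.** For each of the two problems there is a program $P$ with the following properties. 1. There is a polynomial $p$ such that, with any shortest path algorithm $S$ as its subroutine, on every instance, $P$ halts and solves the instance: it outputs a feasible set of minimum cost, or reports that no feasible set exists. It calls $S$ exactly $k\cdot 2^{\ell}$ times, namely exactly once for each pair $(\widetilde F,i)$ with $\widetilde F\subseteq F$ and $1\le i\le k$, on the shortest $s$-$t$ path problem in the subgraph $(V,A_i)$ with the nonnegative costs $c_{\widetilde F}$. Its output is, for some $\widetilde F\subseteq F$, the union of shortest $s$-$t$ paths $P_i$ in $(V,A_i)$ with respect to $c_{\widetilde F}$ for $i=1,\dots,k$, together with all arcs of negative cost. Apart from the steps of $S$, it takes at most $2^{\ell}\cdot p(N)$ steps. 2. There is a shortest path algorithm $S$, running in time polynomial in $|V|+|A|$, such that $P$ with the subroutine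 $S$ is an FPT algorithm with parameter $\ell$: there are a computable function $f\colon\mathbb N\to\mathbb N$ and a polynomial $q$ such that it solves every instance in at most $f(\ell)\cdot q(N)$ steps in total. -/

import Mathlib

namespace SimPaths

noncomputable section

/-! ### Graphs, paths, and the optimization problem -/

/-- The two versions of the problem: digraphs and undirected graphs. -/
inductive GraphKind where
  | directed
  | undirected

/-- A finite graph with vertex set `Fin n` and arc (or edge) set `Fin m`; parallel arcs are allowed.
For undirected graphs, `tail a` and `head a` are the two ends of the edge `a`, in no
significant order. -/
structure FinGraph (n m : ℕ) where
  tail : Fin m → Fin n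
  head : Fin m → Fin n

/-- One can traverse `a` from `u` to `v`: arcs only from tail to head, edges in both ways. -/
def FinGraph.Joins {n m : ℕ} (G : FinGraph n m) (o : GraphKind) (a : Fin m) (u v : Fin n) : Prop :=
  match o with
  | .directed => G.tail a = u ∧ G.head a = v
  | .undirected => (G.tail a = u ∧ G.head a = v) ∨ (G.tail a = v ∧ G.head a = u)

/-- `IsPath G o u w vs as`: the list `as` of arcs (edges) is a dipath (path) from `u` to `w`, and
`vs` is the list of the vertices that it visits, which are pairwise distinct. -/
inductive FinGraph.IsPath {n m : ℕ} (G : FinGraph n m) (o : GraphKind) :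
    Fin n → Fin n → List (Fin n) → List (Fin m) → Prop
  | nil (u : Fin n) : FinGraph.IsPath G o u u [u] []
  | cons {u v w : Fin n} {a : Fin m} {vs : List (Fin n)} {as : List (Fin m)} :
      G.Joins o a u v → FinGraph.IsPath G o v w vs as → u ∉ vs →
      FinGraph.IsPath G o u w (u :: vs) (a :: as)

/-- `P` is the arc (edge) set of an `s`-`t` dipath (path). -/
def FinGraph.IsPathSet {n m : ℕ} (G : FinGraph n m) (o : GraphKind) (s t : Fin n)
    (P : Finset (Fin m)) : Prop :=
  ∃ vs as, G.IsPath o s t vs as ∧ P = as.toFinset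

/-- The cost function `c` is conservative: no directed cycle, that is, no arc `u → v` together
with a dipath from `v` to `u`, has negative cost. -/
def FinGraph.Conservative {n m : ℕ} (G : FinGraph n m) (c : Fin m → ℝ) : Prop :=
  ∀ (u v : Fin n) (a : Fin m) (vs : List (Fin n)) (as : List (Fin m)),
    G.Joins .directed a u v → G.IsPath .directed v u vs as → 0 ≤ c a + (as.map c).sum

/-- The condition on the costs: conservative for digraphs, nonnegative for graphs. -/
def FinGraph.CostOK {n m : ℕ} (G : FinGraph n m) (o : GraphKind) (c : Fin m → ℝ) : Prop :=
  match o with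
  | .directed => G.Conservative c
  | .undirected => ∀ a, 0 ≤ c a

/-- An input of Superset-Simultaneous-Dipaths (`o = directed`) or of Superset-Simultaneous-Paths
(`o = undirected`). -/
structure Instance (o : GraphKind) where
  n : ℕ
  m : ℕ
  k : ℕ
  k_pos : 0 < k
  G : FinGraph n m
  color : Fin k → Finset (Fin m)
  covers : ∀ a, ∃ i, a ∈ color i
  s : Fin n
  t : Fin n
  s_ne_t : s ≠ t
  cost : Fin m → ℝ
  cost_ok : G.CostOK o cost

/-- An input of the shortest path problem with nonnegative costs in the subgraph `(V, arcs)` of a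
given graph. -/
structure SPInstance where
  n : ℕ
  m : ℕ
  G : FinGraph n m
  arcs : Finset (Fin m)
  s : Fin n
  t : Fin n
  cost : Fin m → ℝ
  cost_nonneg : ∀ a ∈ arcs, 0 ≤ cost a

/-- `P` is an `s`-`t` path in the subgraph. -/
def SPInstance.Feasible (o : GraphKind) (q : SPInstance) (P : Finset (Fin q.m)) : Prop :=
  q.G.IsPathSet o q.s q.t P ∧ P ⊆ q.arcs

/-- `P` is a shortest `s`-`t` path in the subgraph. -/
def SPInstance.IsShortest (o : GraphKind) (q : SPInstance) (P : Finset (Fin q.m)) : Prop :=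
  q.Feasible o P ∧ ∀ P', q.Feasible o P' → ∑ a ∈ P, q.cost a ≤ ∑ a ∈ P', q.cost a

namespace Instance

variable {o : GraphKind}

/-- `B ∩ A_i` contains an `s`-`t` path for every color `i`. -/
def Feasible (I : Instance o) (B : Finset (Fin I.m)) : Prop :=
  ∀ i, ∃ P, I.G.IsPathSet o I.s I.t P ∧ P ⊆ B ∩ I.color i

/-- `B` is a feasible set of minimum cost. -/
def Optimal (I : Instance o) (B : Finset (Fin I.m)) : Prop :=
  I.Feasible B ∧ ∀ B', I.Feasible B' → ∑ a ∈ B, I.cost a ≤ ∑ a ∈ B', I.cost a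

/-- The set of multi-colored arcs (edges). -/
def multicolored (I : Instance o) : Finset (Fin I.m) :=
  Finset.univ.filter fun a => ∃ i j, i ≠ j ∧ a ∈ I.color i ∧ a ∈ I.color j

/-- The parameter: the number of multi-colored arcs (edges). -/
def ell (I : Instance o) : ℕ := I.multicolored.card

/-- The input size, up to polynomials: the numbers of vertices, arcs and colors. -/
def size (I : Instance o) : ℕ := I.n + I.m + I.k

/-- The shortest path problem in `(V, A_i)` where the costs on `F` are set to `0` (and negative
costs as well). -/
def query (I : Instance o) (F : Finset (Fin I.m)) (i : Fin I.k) : SPInstance where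
  n := I.n
  m := I.m
  G := I.G
  arcs := I.color i
  s := I.s
  t := I.t
  cost := fun a => if a ∈ F then 0 else max (I.cost a) 0
  cost_nonneg := by
    intro a _
    split_ifs
    · exact le_refl _
    · exact le_max_right _ _

/-- For some set `F` of multi-colored arcs, `B` consists of one shortest path per color, with
respect to the costs modified on `F`, and of the arcs of negative cost. -/
def IsUnionOfShortestPaths (I : Instance o) (B : Finset (Fin I.m)) : Prop :=
  ∃ F ⊆ I.multicolored, ∃ P : Fin I.k → Finset (Fin I.m),
    (∀ i, (I.query F i).IsShortest o (P i)) ∧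
    B = Finset.univ.biUnion P ∪ Finset.univ.filter fun a => I.cost a < 0

end Instance

/-! ### The machine model

A random access machine whose memory consists of arrays of natural numbers and arrays of real
numbers, each of which has a number as its name. Naturals can be added, subtracted (truncated at
`0`), compared and used as addresses; reals can be added, subtracted and compared. There is
no multiplication, so that unit costs are realistic. Every assignment and every evaluation of a
condition takes one step: the expressions in it have a size that only depends on the program. -/

/-- The memory: entry `j` of the array named `A` is `ints A j` or `reals A j`. -/
structure State where
  ints : ℕ → ℕ → ℕ
  reals : ℕ → ℕ → ℝ

/-- Natural-number expressions; `get A e` is entry `e` of the array `A`. -/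
inductive IExp where
  | const (c : ℕ)
  | get (A : ℕ) (e : IExp)
  | add (e₁ e₂ : IExp)
  | sub (e₁ e₂ : IExp)

def IExp.eval (σ : State) : IExp → ℕ
  | .const c => c
  | .get A e => σ.ints A (e.eval σ)
  | .add e₁ e₂ => e₁.eval σ + e₂.eval σ
  | .sub e₁ e₂ => e₁.eval σ - e₂.eval σ

/-- Real-number expressions. -/
inductive RExp where
  | zero
  | get (A : ℕ) (e : IExp)
  | add (e₁ e₂ : RExp)
  | sub (e₁ e₂ : RExp)

def RExp.eval (σ : State) : RExp → ℝ
  | .zero => 0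
  | .get A e => σ.reals A (e.eval σ)
  | .add e₁ e₂ => e₁.eval σ + e₂.eval σ
  | .sub e₁ e₂ => e₁.eval σ - e₂.eval σ

/-- Conditions. -/
inductive BExp where
  | ieq (e₁ e₂ : IExp)
  | ilt (e₁ e₂ : IExp)
  | rlt (e₁ e₂ : RExp)
  | not (b : BExp)
  | and (b₁ b₂ : BExp)

def BExp.Holds (σ : State) : BExp → Prop
  | .ieq e₁ e₂ => e₁.eval σ = e₂.eval σ
  | .ilt e₁ e₂ => e₁.eval σ < e₂.eval σ
  | .rlt e₁ e₂ => e₁.eval σ < e₂.eval σ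
  | .not b => ¬ b.Holds σ
  | .and b₁ b₂ => b₁.Holds σ ∧ b₂.Holds σ

/-- Programs; `call` executes the subroutine. -/
inductive Prog where
  | skip
  | setInt (A : ℕ) (i : IExp) (e : IExp)
  | setReal (A : ℕ) (i : IExp) (e : RExp)
  | seq (p q : Prog)
  | ite (b : BExp) (p q : Prog)
  | loop (b : BExp) (p : Prog)
  | call

def State.setInt (σ : State) (A j v : ℕ) : State :=
  { σ with ints := Function.update σ.ints A (Function.update (σ.ints A) j v) }

def State.setReal (σ : State) (A j : ℕ) (v : ℝ) : State :=
  { σ with reals := Function.update σ.reals A (Function.update (σ.reals A) j v) }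

/-- `Exec sub p σ σ' t calls`: started in memory `σ`, the program `p` halts after `t` steps in
memory `σ'`. Here `sub σ₁ σ₂ u` says that the subroutine, started in `σ₁`, halts after `u` steps in
`σ₂`; these steps are counted in `t`. The list `calls` holds, for each execution of the subroutine
in order, the memory in which it was called and the number of steps that it took. -/
inductive Exec (sub : State → State → ℕ → Prop) :
    Prog → State → State → ℕ → List (State × ℕ) → Prop
  | skip (σ : State) : Exec sub .skip σ σ 1 []
  | setInt (A : ℕ) (i e : IExp) (σ : State) :
      Exec sub (.setInt A i e) σ (σ.setInt A (i.eval σ) (e.eval σ)) 1 []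
  | setReal (A : ℕ) (i : IExp) (e : RExp) (σ : State) :
      Exec sub (.setReal A i e) σ (σ.setReal A (i.eval σ) (e.eval σ)) 1 []
  | seq {p q : Prog} {σ σ₁ σ₂ : State} {t₁ t₂ : ℕ} {c₁ c₂ : List (State × ℕ)} :
      Exec sub p σ σ₁ t₁ c₁ → Exec sub q σ₁ σ₂ t₂ c₂ →
      Exec sub (.seq p q) σ σ₂ (t₁ + t₂) (c₁ ++ c₂)
  | ite_true {b : BExp} {p q : Prog} {σ σ' : State} {t : ℕ} {c : List (State × ℕ)} :
      b.Holds σ → Exec sub p σ σ' t c → Exec sub (.ite b p q) σ σ' (t + 1) c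
  | ite_false {b : BExp} {p q : Prog} {σ σ' : State} {t : ℕ} {c : List (State × ℕ)} :
      ¬ b.Holds σ → Exec sub q σ σ' t c → Exec sub (.ite b p q) σ σ' (t + 1) c
  | loop_true {b : BExp} {p : Prog} {σ σ₁ σ₂ : State} {t₁ t₂ : ℕ} {c₁ c₂ : List (State × ℕ)} :
      b.Holds σ → Exec sub p σ σ₁ t₁ c₁ → Exec sub (.loop b p) σ₁ σ₂ t₂ c₂ →
      Exec sub (.loop b p) σ σ₂ (t₁ + t₂ + 1) (c₁ ++ c₂)
  | loop_false {b : BExp} {p : Prog} {σ : State} :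
      ¬ b.Holds σ → Exec sub (.loop b p) σ σ 1 []
  | call {σ σ' : State} {t : ℕ} :
      sub σ σ' t → Exec sub .call σ σ' (t + 1) [(σ, t)]

/-- Execution of a program that has no subroutine at its disposal. -/
def Runs (S : Prog) (σ σ' : State) (t : ℕ) : Prop :=
  Exec (fun _ _ _ => False) S σ σ' t []

/-- Execution of the program `P` with the program `S` as its subroutine. -/
def RunsWith (S P : Prog) (σ σ' : State) (t : ℕ) (calls : List (State × ℕ)) : Prop :=
  Exec (Runs S) P σ σ' t calls

/-! ### Input and output conventions

Arrays with even names belong to the main program, those with odd names to the subroutine. A set of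
arcs is given by its `0`-`1` indicator. All other memory contents are arbitrary at the start. -/

/-- The array named `A` holds the indicator of the set `B`. -/
def State.HoldsSet (σ : State) (A : ℕ) {m : ℕ} (B : Finset (Fin m)) : Prop :=
  ∀ a : Fin m, σ.ints A a = if a ∈ B then 1 else 0

/-- Input of the main problem: numbers `n, m, k, s, t` in array `0`, the ends of the arcs in the
arrays `2` and `4`, the color classes row by row in array `6`, the costs in the real array `0`. -/
structure Instance.EncodedIn {o : GraphKind} (I : Instance o) (σ : State) : Prop where
  n_eq : σ.ints 0 0 = I.n
  m_eq : σ.ints 0 1 = I.m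
  k_eq : σ.ints 0 2 = I.k
  s_eq : σ.ints 0 3 = I.s
  t_eq : σ.ints 0 4 = I.t
  tail_eq : ∀ a : Fin I.m, σ.ints 2 a = I.G.tail a
  head_eq : ∀ a : Fin I.m, σ.ints 4 a = I.G.head a
  color_eq : ∀ (i : Fin I.k) (a : Fin I.m),
    σ.ints 6 (i * I.m + a) = if a ∈ I.color i then 1 else 0
  cost_eq : ∀ a : Fin I.m, σ.reals 0 a = I.cost a

/-- Output of the main problem: an optimal set in array `10` and the flag `1` in array `8`, or the
flag `0` if no feasible set exists. The optimal set is a union of shortest paths as above. -/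
def Instance.SolvedIn {o : GraphKind} (I : Instance o) (σ : State) : Prop :=
  (σ.ints 8 0 = 1 ∧ ∃ B, I.Optimal B ∧ I.IsUnionOfShortestPaths B ∧ σ.HoldsSet 10 B) ∨
  (σ.ints 8 0 = 0 ∧ ¬ ∃ B, I.Feasible B)

/-- Input of the shortest path problem: numbers `n, m, s, t` in array `1`, the ends of the arcs in
the arrays `3` and `5`, the arcs of the subgraph in array `7`, the costs in the real array `1`. -/
structure SPInstance.EncodedIn (q : SPInstance) (σ : State) : Prop where
  n_eq : σ.ints 1 0 = q.n
  m_eq : σ.ints 1 1 = q.m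
  s_eq : σ.ints 1 2 = q.s
  t_eq : σ.ints 1 3 = q.t
  tail_eq : ∀ a : Fin q.m, σ.ints 3 a = q.G.tail a
  head_eq : ∀ a : Fin q.m, σ.ints 5 a = q.G.head a
  arcs_eq : σ.HoldsSet 7 q.arcs
  cost_eq : ∀ a : Fin q.m, σ.reals 1 a = q.cost a

/-- Output of the shortest path problem: a shortest path in array `11` and the flag `1` in array
`9`, or the flag `0` if there is no path. -/
def SPInstance.SolvedIn (o : GraphKind) (q : SPInstance) (σ : State) : Prop :=
  (σ.ints 9 0 = 1 ∧ ∃ P, q.IsShortest o P ∧ σ.HoldsSet 11 P) ∨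
  (σ.ints 9 0 = 0 ∧ ¬ ∃ P, q.Feasible o P)

/-- The subroutine calling convention: the arrays with even names are not changed. -/
def SameEvenArrays (σ σ' : State) : Prop :=
  ∀ A, Even A → σ'.ints A = σ.ints A ∧ σ'.reals A = σ.reals A

/-- `S` is an algorithm for the shortest path problem with nonnegative costs (in digraphs or in
graphs), usable as a subroutine. -/
def IsShortestPathAlgorithm (o : GraphKind) (S : Prog) : Prop :=
  ∀ (q : SPInstance) (σ : State), q.EncodedIn σ →
    ∃ σ' t, Runs S σ σ' t ∧ q.SolvedIn o σ' ∧ SameEvenArrays σ σ'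

/-- On every shortest path instance, `S` halts after a number of steps that is polynomial in the
numbers of vertices and arcs. -/
def IsPolynomialTime (S : Prog) : Prop :=
  ∃ p : Polynomial ℕ, ∀ (q : SPInstance) (σ : State), q.EncodedIn σ →
    ∃ σ' t, Runs S σ σ' t ∧ t ≤ p.eval (q.n + q.m)

/-- The program `P` with the subroutine `S` solves every instance in at most `f(ℓ) · poly(N)` steps,
where `f` is computable, `ℓ` is the number of multi-colored arcs and `N` is the input size. -/
def IsFPTAlgorithm (o : GraphKind) (S P : Prog) : Prop :=
  ∃ (f : ℕ → ℕ) (p : Polynomial ℕ), Computable f ∧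
    ∀ (I : Instance o) (σ : State), I.EncodedIn σ →
      ∃ σ' t calls, RunsWith S P σ σ' t calls ∧ I.SolvedIn σ' ∧ t ≤ f I.ell * p.eval I.size

/-- The executions of the subroutine recorded in `calls` are, in some order, exactly one for each
pair of a set `F` of multi-colored arcs and a color `i`, namely on the shortest path problem in
`(V, A_i)` with the costs modified on `F`. -/
def Instance.CallsAreQueries {o : GraphKind} (I : Instance o) (calls : List (State × ℕ)) : Prop :=
  ∃ L : List (Finset (Fin I.m) × Fin I.k), L.Nodup ∧ (∀ x, x ∈ L ↔ x.1 ⊆ I.multicolored) ∧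
    List.Forall₂ (fun x call => (I.query x.1 x.2).EncodedIn call.1) L calls

end

end SimPaths

open SimPaths

namespace SimPaths

/-! ### Memory updates -/

/-! Let B be feasible, choose s-t paths Q_i ⊆ B ∩ A_i, put F̃ = F ∩ B, and let P_i be shortest in
(V, A_i) for c_F̃. An arc in two of the Q_i is multi-colored and lies in B, hence in F̃; so the sets
Q_i \ F̃ are disjoint. With c⁺ = max(c, 0), c⁺(⋃ P_i) ≤ c⁺(F̃) + ∑ c_F̃(P_i) ≤ c⁺(F̃) + ∑ c_F̃(Q_i)
= c⁺(F̃) + ∑ c⁺(Q_i \ F̃) ≤ c⁺(B). Adding all arcs of negative cost does not change c⁺ of the union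
and makes its negative part as small as possible. So the union costs at most as much as B
(`Instance.sum_union_le`), for any choice of the shortest paths, and it is feasible
(`Instance.feasible_union`). Hence the cheapest union over all 2^ℓ guesses of F̃ is optimal, and a
color without a path shows that there is no feasible set.

The guesses are enumerated by a binary counter on F (`nextSubset_ensures`). The invariant in
`mainProg_ensures` carries the family of subsets treated so far: the current subset has rank equal
to its size, so no subset is repeated, and after 2^ℓ rounds all have been treated. This gives the
exact list of calls, the factor 2^ℓ and the optimality together.

For the second part the subroutine is Dijkstra's algorithm, run from t towards s without a priority
queue. Its induction step is `Settled.insert`, which rests on `FinGraph.IsPath.le_of_crossing`. The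
total time follows from the number of calls and determinism of the machine.

Programs are verified in a Hoare-style calculus, `Ensures`, which charges the steps of the
subroutine separately. Frames, computed from the syntax of a program, tell which arrays stay
unchanged. -/

@[simp] theorem State.ints_setInt (σ : State) (A j v B k : ℕ) :
    (σ.setInt A j v).ints B k = if B = A ∧ k = j then v else σ.ints B k := by
  by_cases hB : B = A
  · subst hB
    by_cases hk : k = j <;> simp [State.setInt, hk]
  · simp [State.setInt, hB]

@[simp] theorem State.reals_setInt (σ : State) (A j v : ℕ) : (σ.setInt A j v).reals = σ.reals := rfl

@[simp] theorem State.ints_setReal (σ : State) (A j : ℕ) (v : ℝ) :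
    (σ.setReal A j v).ints = σ.ints := rfl

@[simp] theorem State.reals_setReal (σ : State) (A j : ℕ) (v : ℝ) (B k : ℕ) :
    (σ.setReal A j v).reals B k = if B = A ∧ k = j then v else σ.reals B k := by
  by_cases hB : B = A
  · subst hB
    by_cases hk : k = j <;> simp [State.setReal, hk]
  · simp [State.setReal, hB]

theorem State.ints_setInt_of_ne (σ : State) {A B : ℕ} (j v : ℕ) (h : B ≠ A) :
    (σ.setInt A j v).ints B = σ.ints B := by
  simp [State.setInt, h]

theorem State.reals_setReal_of_ne (σ : State) {A B : ℕ} (j : ℕ) (v : ℝ) (h : B ≠ A) :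
    (σ.setReal A j v).reals B = σ.reals B := by
  simp [State.setReal, h]

/-! ### Executions -/

theorem Exec.mono {sub sub' : State → State → ℕ → Prop} (h : ∀ σ σ' t, sub σ σ' t → sub' σ σ' t)
    {p : Prog} {σ σ' : State} {t : ℕ} {c : List (State × ℕ)} (e : Exec sub p σ σ' t c) :
    Exec sub' p σ σ' t c := by
  induction e with
  | skip σ => exact .skip σ
  | setInt A i e σ => exact .setInt A i e σ
  | setReal A i e σ => exact .setReal A i e σ
  | seq _ _ h₁ h₂ => exact .seq h₁ h₂
  | ite_true hb _ h₁ => exact .ite_true hb h₁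
  | ite_false hb _ h₁ => exact .ite_false hb h₁
  | loop_true hb _ _ h₁ h₂ => exact .loop_true hb h₁ h₂
  | loop_false hb => exact .loop_false hb
  | call hs => exact .call (h _ _ _ hs)

/-- A polynomial time bound asserts that some run is short; determinism transfers it to the runs
recorded in a list of calls. -/
theorem Exec.deterministic {sub : State → State → ℕ → Prop}
    (hsub : ∀ σ σ₁ σ₂ t₁ t₂, sub σ σ₁ t₁ → sub σ σ₂ t₂ → σ₁ = σ₂ ∧ t₁ = t₂)
    {p : Prog} {σ σ₁ σ₂ : State} {t₁ t₂ : ℕ} {c₁ c₂ : List (State × ℕ)}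
    (e₁ : Exec sub p σ σ₁ t₁ c₁) (e₂ : Exec sub p σ σ₂ t₂ c₂) :
    σ₁ = σ₂ ∧ t₁ = t₂ ∧ c₁ = c₂ := by
  induction e₁ generalizing σ₂ t₂ c₂ with
  | skip σ => cases e₂; simp
  | setInt A i e σ => cases e₂; simp
  | setReal A i e σ => cases e₂; simp
  | seq _ _ h₁ h₂ =>
    cases e₂ with
    | seq a b =>
      obtain ⟨rfl, rfl, rfl⟩ := h₁ a
      obtain ⟨rfl, rfl, rfl⟩ := h₂ b
      simp
  | ite_true hb _ h₁ =>
    cases e₂ with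
    | ite_true _ a => obtain ⟨rfl, rfl, rfl⟩ := h₁ a; simp
    | ite_false hb' _ => exact absurd hb hb'
  | ite_false hb _ h₁ =>
    cases e₂ with
    | ite_true hb' _ => exact absurd hb' hb
    | ite_false _ a => obtain ⟨rfl, rfl, rfl⟩ := h₁ a; simp
  | loop_true hb _ _ h₁ h₂ =>
    cases e₂ with
    | loop_true _ a b =>
      obtain ⟨rfl, rfl, rfl⟩ := h₁ a
      obtain ⟨rfl, rfl, rfl⟩ := h₂ b
      simp
    | loop_false hb' => exact absurd hb hb'
  | loop_false hb =>
    cases e₂ with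
    | loop_true hb' _ _ => exact absurd hb' hb
    | loop_false _ => simp
  | call hs =>
    cases e₂ with
    | call hs' => obtain ⟨rfl, rfl⟩ := hsub _ _ _ _ _ hs hs'; simp

theorem Runs.deterministic {S : Prog} {σ σ₁ σ₂ : State} {t₁ t₂ : ℕ} (h₁ : Runs S σ σ₁ t₁)
    (h₂ : Runs S σ σ₂ t₂) : σ₁ = σ₂ ∧ t₁ = t₂ := by
  have := Exec.deterministic (fun _ _ _ _ _ h => h.elim) h₁ h₂
  exact ⟨this.1, this.2.1⟩

theorem Exec.exists_of_mem_calls {sub : State → State → ℕ → Prop} {p : Prog} {σ σ' : State} {t : ℕ}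
    {c : List (State × ℕ)} (e : Exec sub p σ σ' t c) : ∀ x ∈ c, ∃ τ, sub x.1 τ x.2 := by
  induction e with
  | seq _ _ h₁ h₂ => exact fun x hx => (List.mem_append.1 hx).elim (h₁ x) (h₂ x)
  | ite_true _ _ h => exact h
  | ite_false _ _ h => exact h
  | loop_true _ _ _ h₁ h₂ => exact fun x hx => (List.mem_append.1 hx).elim (h₁ x) (h₂ x)
  | call hs =>
    intro x hx
    obtain rfl := List.mem_singleton.1 hx
    exact ⟨_, hs⟩
  | _ => simp

/-! ### Frames -/

/-- The program may write to the array of naturals named `A`; subroutines may write to all arrays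
with odd names. -/
def Prog.WritesInt : Prog → ℕ → Prop
  | .skip, _ => False
  | .setInt B _ _, A => A = B
  | .setReal _ _ _, _ => False
  | .seq p q, A => p.WritesInt A ∨ q.WritesInt A
  | .ite _ p q, A => p.WritesInt A ∨ q.WritesInt A
  | .loop _ p, A => p.WritesInt A
  | .call, A => ¬ Even A

/-- The program may write to the array of reals named `A`. -/
def Prog.WritesReal : Prog → ℕ → Prop
  | .skip, _ => False
  | .setInt _ _ _, _ => False
  | .setReal B _ _, A => A = B
  | .seq p q, A => p.WritesReal A ∨ q.WritesReal A
  | .ite _ p q, A => p.WritesReal A ∨ q.WritesReal A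
  | .loop _ p, A => p.WritesReal A
  | .call, A => ¬ Even A

/-- `σ` and `σ'` differ at most in arrays that `p` may write to. -/
structure Frame (p : Prog) (σ σ' : State) : Prop where
  ints : ∀ A, ¬ p.WritesInt A → σ'.ints A = σ.ints A
  reals : ∀ A, ¬ p.WritesReal A → σ'.reals A = σ.reals A

theorem Frame.refl (p : Prog) (σ : State) : Frame p σ σ := ⟨fun _ _ => rfl, fun _ _ => rfl⟩

theorem Frame.trans {p : Prog} {σ σ₁ σ₂ : State} (h₁ : Frame p σ σ₁) (h₂ : Frame p σ₁ σ₂) :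
    Frame p σ σ₂ :=
  ⟨fun A hA => (h₂.ints A hA).trans (h₁.ints A hA),
    fun A hA => (h₂.reals A hA).trans (h₁.reals A hA)⟩

theorem Frame.weaken {p q : Prog} {σ σ' : State} (h : Frame p σ σ')
    (hi : ∀ A, p.WritesInt A → q.WritesInt A) (hr : ∀ A, p.WritesReal A → q.WritesReal A) :
    Frame q σ σ' :=
  ⟨fun A hA => h.ints A fun h' => hA (hi A h'), fun A hA => h.reals A fun h' => hA (hr A h')⟩

/-- The set of written arrays is read off the syntax, so for concrete programs an unchanged array
needs no argument about the execution. The subroutine enters only through the calling convention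
`hsub`. -/
theorem Exec.frame {sub : State → State → ℕ → Prop}
    (hsub : ∀ σ σ' t, sub σ σ' t → SameEvenArrays σ σ') {p : Prog} {σ σ' : State} {t : ℕ}
    {c : List (State × ℕ)} (e : Exec sub p σ σ' t c) : Frame p σ σ' := by
  induction e with
  | skip σ => exact .refl _ _
  | setInt A i e σ =>
    exact ⟨fun B hB => State.ints_setInt_of_ne _ _ _ hB, fun B _ => rfl⟩
  | setReal A i e σ =>
    exact ⟨fun B _ => rfl, fun B hB => State.reals_setReal_of_ne _ _ _ hB⟩
  | seq _ _ h₁ h₂ =>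
    exact (h₁.weaken (fun _ => Or.inl) (fun _ => Or.inl)).trans
      (h₂.weaken (fun _ => Or.inr) (fun _ => Or.inr))
  | ite_true _ _ h => exact h.weaken (fun _ => Or.inl) (fun _ => Or.inl)
  | ite_false _ _ h => exact h.weaken (fun _ => Or.inr) (fun _ => Or.inr)
  | loop_true _ _ _ h₁ h₂ => exact .trans (.weaken h₁ (fun _ => id) (fun _ => id)) h₂
  | loop_false _ => exact .refl _ _
  | call hs =>
    exact ⟨fun A hA => (hsub _ _ _ hs A (not_not.1 hA)).1,
      fun A hA => (hsub _ _ _ hs A (not_not.1 hA)).2⟩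

/-! ### Total correctness with step bounds -/

section Logic

variable {sub : State → State → ℕ → Prop}

/-- Started in `σ`, the program `p` halts after at most `T` steps, not counting those of the
subroutine, in a memory `σ'` such that `Q σ' l'`, where `l'` is `l` extended by the calls. -/
def Ensures (sub : State → State → ℕ → Prop) (p : Prog) (σ : State) (l : List (State × ℕ)) (T : ℕ)
    (Q : State → List (State × ℕ) → Prop) : Prop :=
  ∃ σ' t c, Exec sub p σ σ' t c ∧ t ≤ T + (c.map Prod.snd).sum ∧ Q σ' (l ++ c)

theorem Ensures.consequence {p : Prog} {σ : State} {l : List (State × ℕ)} {T T' : ℕ}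
    {Q Q' : State → List (State × ℕ) → Prop} (h : Ensures sub p σ l T Q)
    (hsub : ∀ σ σ' t, sub σ σ' t → SameEvenArrays σ σ') (hT : T ≤ T')
    (hQ : ∀ σ' l', Frame p σ σ' → Q σ' l' → Q' σ' l') : Ensures sub p σ l T' Q' := by
  obtain ⟨σ', t, c, he, ht, hq⟩ := h
  exact ⟨σ', t, c, he, by omega, hQ _ _ (he.frame hsub) hq⟩

theorem Ensures.le {p : Prog} {σ : State} {l : List (State × ℕ)} {T T' : ℕ}
    {Q : State → List (State × ℕ) → Prop} (h : Ensures sub p σ l T Q) (hT : T ≤ T') :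
    Ensures sub p σ l T' Q := by
  obtain ⟨σ', t, c, he, ht, hq⟩ := h
  exact ⟨σ', t, c, he, by omega, hq⟩

theorem Ensures.seq {p q : Prog} {σ : State} {l : List (State × ℕ)} {T₁ T₂ : ℕ}
    {Q₁ Q : State → List (State × ℕ) → Prop} (h₁ : Ensures sub p σ l T₁ Q₁)
    (hsub : ∀ σ σ' t, sub σ σ' t → SameEvenArrays σ σ')
    (h₂ : ∀ σ₁ l₁, Frame p σ σ₁ → Q₁ σ₁ l₁ → Ensures sub q σ₁ l₁ T₂ Q) :
    Ensures sub (.seq p q) σ l (T₁ + T₂) Q := by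
  obtain ⟨σ₁, t₁, c₁, he₁, ht₁, hq₁⟩ := h₁
  obtain ⟨σ₂, t₂, c₂, he₂, ht₂, hq₂⟩ := h₂ _ _ (he₁.frame hsub) hq₁
  refine ⟨σ₂, t₁ + t₂, c₁ ++ c₂, .seq he₁ he₂, ?_, by simpa using hq₂⟩
  simp only [List.map_append, List.sum_append]
  omega

theorem Ensures.ite {b : BExp} {p q : Prog} {σ : State} {l : List (State × ℕ)} {T : ℕ}
    {Q : State → List (State × ℕ) → Prop} (h₁ : b.Holds σ → Ensures sub p σ l T Q)
    (h₂ : ¬ b.Holds σ → Ensures sub q σ l T Q) : Ensures sub (.ite b p q) σ l (T + 1) Q := by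
  by_cases hb : b.Holds σ
  · obtain ⟨σ', t, c, he, ht, hq⟩ := h₁ hb
    exact ⟨σ', t + 1, c, .ite_true hb he, by omega, hq⟩
  · obtain ⟨σ', t, c, he, ht, hq⟩ := h₂ hb
    exact ⟨σ', t + 1, c, .ite_false hb he, by omega, hq⟩

/-- The rule for loops that are executed at most `N` times. -/
theorem Ensures.loop {b : BExp} {p : Prog} {Tb : ℕ} {Q : State → List (State × ℕ) → Prop}
    (Inv : ℕ → State → List (State × ℕ) → Prop) (N : ℕ) (σ : State) (l : List (State × ℕ))
    (h0 : Inv N σ l)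
    (hstep : ∀ j σ l, Inv j σ l → b.Holds σ →
      ∃ i < j, Ensures sub p σ l Tb (Inv i))
    (hdone : ∀ j σ l, Inv j σ l → ¬ b.Holds σ → Q σ l) :
    Ensures sub (.loop b p) σ l (N * (Tb + 1) + 1) Q := by
  induction N using Nat.strong_induction_on generalizing σ l with
  | _ N ih =>
    by_cases hb : b.Holds σ
    · obtain ⟨i, hi, σ₁, t₁, c₁, he₁, ht₁, hq₁⟩ := hstep N σ l h0 hb
      obtain ⟨σ₂, t₂, c₂, he₂, ht₂, hq₂⟩ := ih i hi σ₁ _ hq₁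
      refine ⟨σ₂, _, _, .loop_true hb he₁ he₂, ?_, by simpa using hq₂⟩
      -- The round just executed and the `i` rounds still allowed fit into the budget because `i <
      -- N`; the index may drop by more than one.
      have : (i + 1) * (Tb + 1) ≤ N * (Tb + 1) := Nat.mul_le_mul_right _ hi
      rw [Nat.add_mul, one_mul] at this
      simp only [List.map_append, List.sum_append]
      omega
    · exact ⟨σ, 1, [], .loop_false hb, by omega, by simpa using hdone N σ l h0 hb⟩

/-- `for i = 0, ..., N - 1` where `N` is entry `c` of the array `B`. -/
def forLoop (i B c : ℕ) (p : Prog) : Prog :=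
  .seq (.setInt i (.const 0) (.const 0))
    (.loop (.ilt (.get i (.const 0)) (.get B (.const c)))
      (.seq p (.setInt i (.const 0) (.add (.get i (.const 0)) (.const 1)))))

/-- Each round costs the body, the increment and the test, whence `Tb + 2`; the final `2` is the
initialization and the failing test. The body must not write to the counter or to the bound, and the
invariant is required after the increment. -/
theorem Ensures.forLoop {i B c N Tb : ℕ} {p : Prog} {σ₀ : State} {l₀ : List (State × ℕ)}
    {Q : State → List (State × ℕ) → Prop}
    (hsub : ∀ σ σ' t, sub σ σ' t → SameEvenArrays σ σ')
    (Inv : ℕ → State → List (State × ℕ) → Prop)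
    (hN : σ₀.ints B c = N) (hB : B ≠ i) (hpB : ¬ p.WritesInt B) (hpi : ¬ p.WritesInt i)
    (h0 : Inv 0 (σ₀.setInt i 0 0) l₀)
    (hstep : ∀ j < N, ∀ σ l, Frame (forLoop i B c p) σ₀ σ → σ.ints i 0 = j → Inv j σ l →
      Ensures sub p σ l Tb (fun σ' l' => Frame p σ σ' → Inv (j + 1) (σ'.setInt i 0 (j + 1)) l'))
    (hdone : ∀ σ l, Frame (forLoop i B c p) σ₀ σ → Inv N σ l → Q σ l) :
    Ensures sub (forLoop i B c p) σ₀ l₀ (N * (Tb + 2) + 2) Q := by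
  have hfr : ∀ σ, Frame (.setInt i (.const 0) (.const 0)) σ₀ σ →
      Frame (SimPaths.forLoop i B c p) σ₀ σ := fun σ h =>
    h.weaken (fun _ => Or.inl) (fun _ => Or.inl)
  have hset : ∀ σ v, Frame (SimPaths.forLoop i B c p) σ (σ.setInt i 0 v) := fun σ v =>
    ⟨fun A hA => State.ints_setInt_of_ne _ _ _ fun h => hA (Or.inl h), fun A _ => rfl⟩
  have hBw : ¬ (SimPaths.forLoop i B c p).WritesInt B := by
    rintro (h | h | h)
    exacts [hB h, hpB h, hB h]
  refine (Ensures.seq (T₁ := 1) (T₂ := N * (Tb + 2) + 1)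
    (Q₁ := fun σ l => σ = σ₀.setInt i 0 0 ∧ l = l₀)
    ⟨_, 1, [], .setInt _ _ _ _, by omega, by simp [IExp.eval]⟩ hsub ?_).le (by omega)
  rintro _ _ - ⟨rfl, rfl⟩
  -- The index `j` counts the remaining rounds and `j'` is the counter itself. The frame relative to
  -- the initial memory is part of the invariant, so that each round can use it.
  refine Ensures.loop (fun j σ l => ∃ j', j' + j = N ∧ σ.ints i 0 = j' ∧
    Frame (SimPaths.forLoop i B c p) σ₀ σ ∧ Inv j' σ l) N _ _ ⟨0, by simp, by simp, hset _ _, h0⟩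
    ?_ ?_
  · rintro j σ l ⟨j', hj, hi, hF, hI⟩ hb
    simp only [BExp.Holds, IExp.eval, hi, hF.ints B hBw, hN] at hb
    refine ⟨j - 1, by omega, ?_⟩
    obtain ⟨σ₁, t₁, c₁, he₁, ht₁, hq₁⟩ := hstep j' hb σ l hF hi hI
    have hF₁ := he₁.frame hsub
    have hi₁ : σ₁.ints i 0 = j' := by rw [hF₁.ints i hpi, hi]
    refine ⟨σ₁.setInt i 0 (j' + 1), t₁ + 1, c₁ ++ [], .seq he₁ ?_, by simp; omega, ?_⟩
    · have := Exec.setInt (sub := sub) i (.const 0) (.add (.get i (.const 0)) (.const 1)) σ₁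
      simpa [IExp.eval, hi₁] using this
    · refine ⟨j' + 1, by omega, by simp, ?_, by simpa using hq₁ hF₁⟩
      exact (hF.trans (hF₁.weaken (fun _ h => Or.inr (Or.inl h))
        (fun _ h => Or.inr (Or.inl h)))).trans (hset _ _)
  · rintro j σ l ⟨j', hj, hi, hF, hI⟩ hb
    simp only [BExp.Holds, IExp.eval, hi, hF.ints B hBw, hN] at hb
    obtain rfl : j' = N := by omega
    exact hdone σ l hF hI

/-- Weakest preconditions of programs without loops and calls. -/
def Prog.wp : Prog → (State → Prop) → State → Prop
  | .skip, Q, σ => Q σ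
  | .setInt A i e, Q, σ => Q (σ.setInt A (i.eval σ) (e.eval σ))
  | .setReal A i e, Q, σ => Q (σ.setReal A (i.eval σ) (e.eval σ))
  | .seq p q, Q, σ => p.wp (q.wp Q) σ
  | .ite b p q, Q, σ => (b.Holds σ → p.wp Q σ) ∧ (¬ b.Holds σ → q.wp Q σ)
  | .loop _ _, _, _ => False
  | .call, _, _ => False

/-- An upper bound on the number of steps of a program without loops and calls. -/
def Prog.length : Prog → ℕ
  | .skip => 1
  | .setInt _ _ _ => 1
  | .setReal _ _ _ => 1
  | .seq p q => p.length + q.length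
  | .ite _ p q => p.length + q.length + 1
  | .loop _ _ => 0
  | .call => 0

theorem Prog.exists_exec_of_wp (p : Prog) {Q : State → Prop} {σ : State} (h : p.wp Q σ) :
    ∃ σ' t, Exec sub p σ σ' t [] ∧ t ≤ p.length ∧ Q σ' := by
  induction p generalizing Q σ with
  | skip => exact ⟨_, _, .skip _, le_rfl, h⟩
  | setInt A i e => exact ⟨_, _, .setInt _ _ _ _, le_rfl, h⟩
  | setReal A i e => exact ⟨_, _, .setReal _ _ _ _, le_rfl, h⟩
  | seq p q hp hq =>
    obtain ⟨σ₁, t₁, e₁, ht₁, h₁⟩ := hp h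
    obtain ⟨σ₂, t₂, e₂, ht₂, h₂⟩ := hq h₁
    exact ⟨σ₂, _, .seq e₁ e₂, Nat.add_le_add ht₁ ht₂, h₂⟩
  | ite b p q hp hq =>
    by_cases hb : b.Holds σ
    · obtain ⟨σ', t, e, ht, h'⟩ := hp (h.1 hb)
      exact ⟨σ', _, .ite_true hb e, by simp only [Prog.length]; omega, h'⟩
    · obtain ⟨σ', t, e, ht, h'⟩ := hq (h.2 hb)
      exact ⟨σ', _, .ite_false hb e, by simp only [Prog.length]; omega, h'⟩
  | loop b p => exact h.elim
  | call => exact h.elim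

/-- Straight-line code is verified by unfolding `Prog.wp` and simplifying memory updates. -/
theorem Ensures.of_wp {p : Prog} {σ : State} {l : List (State × ℕ)} {T : ℕ} {Q : State → Prop}
    (h : p.wp Q σ) (hT : p.length ≤ T) : Ensures sub p σ l T fun σ' l' => l' = l ∧ Q σ' := by
  obtain ⟨σ', t, e, ht, h'⟩ := p.exists_exec_of_wp (sub := sub) h
  exact ⟨σ', t, [], e, by simpa using ht.trans hT, by simpa using h'⟩

end Logic

/-! ### Paths -/

section Paths

variable {n m : ℕ} {G : FinGraph n m} {o : GraphKind}

theorem FinGraph.Joins.ends {a : Fin m} {u v x y : Fin n} (h : G.Joins o a u v)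
    (h' : G.Joins o a x y) : (u = x ∨ u = y) ∧ (v = x ∨ v = y) := by
  cases o <;> simp only [FinGraph.Joins] at h h' <;> aesop

theorem FinGraph.IsPath.start_mem {u w : Fin n} {vs : List (Fin n)} {as : List (Fin m)}
    (h : G.IsPath o u w vs as) : u ∈ vs := by
  cases h <;> simp

theorem FinGraph.IsPath.end_mem {u w : Fin n} {vs : List (Fin n)} {as : List (Fin m)}
    (h : G.IsPath o u w vs as) : w ∈ vs := by
  induction h with
  | nil => simp
  | cons _ _ _ ih => exact List.mem_cons_of_mem _ ih

theorem FinGraph.IsPath.ends_mem {u w : Fin n} {vs : List (Fin n)} {as : List (Fin m)}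
    (h : G.IsPath o u w vs as) {a : Fin m} (ha : a ∈ as) {x y : Fin n} (hj : G.Joins o a x y) :
    x ∈ vs ∧ y ∈ vs := by
  induction h with
  | nil => simp at ha
  | cons hj' hp _ ih =>
    rcases List.mem_cons.1 ha with rfl | ha
    · have := hp.start_mem
      obtain ⟨h₁, h₂⟩ := hj.ends hj'
      constructor
      · rcases h₁ with rfl | rfl <;> simp [this]
      · rcases h₂ with rfl | rfl <;> simp [this]
    · exact ⟨List.mem_cons_of_mem _ (ih ha).1, List.mem_cons_of_mem _ (ih ha).2⟩

/-- If the first arc occurred again, its start would be a vertex of the rest of the path. Hence the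
cost of a path as a list equals the cost of its arc set. -/
theorem FinGraph.IsPath.nodup_arcs {u w : Fin n} {vs : List (Fin n)} {as : List (Fin m)}
    (h : G.IsPath o u w vs as) : as.Nodup := by
  induction h with
  | nil => simp
  | cons hj hp hu ih => exact List.nodup_cons.2 ⟨fun ha => hu (hp.ends_mem ha hj).1, ih⟩

theorem FinGraph.IsPath.nodup {u w : Fin n} {vs : List (Fin n)} {as : List (Fin m)}
    (h : G.IsPath o u w vs as) : vs.Nodup := by
  induction h with
  | nil => simp
  | cons _ _ hu ih => exact List.nodup_cons.2 ⟨hu, ih⟩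

theorem FinGraph.IsPath.length_eq {u w : Fin n} {vs : List (Fin n)} {as : List (Fin m)}
    (h : G.IsPath o u w vs as) : vs.length = as.length + 1 := by
  induction h with
  | nil => simp
  | cons _ _ _ ih => simp [ih]

theorem FinGraph.IsPath.length_lt {u w : Fin n} {vs : List (Fin n)} {as : List (Fin m)}
    (h : G.IsPath o u w vs as) : as.length < n := by
  have := h.nodup.length_le_card
  rw [h.length_eq, Fintype.card_fin] at this
  exact this

theorem FinGraph.IsPath.sum_toFinset {u w : Fin n} {vs : List (Fin n)} {as : List (Fin m)}
    (h : G.IsPath o u w vs as) (c : Fin m → ℝ) :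
    ∑ a ∈ as.toFinset, c a = (as.map c).sum :=
  List.sum_toFinset c h.nodup_arcs

end Paths

/-! ### Encodings -/

theorem State.HoldsSet.congr {σ σ' : State} {A m : ℕ} {B : Finset (Fin m)} (h : σ.HoldsSet A B)
    (hA : σ'.ints A = σ.ints A) : σ'.HoldsSet A B := by
  intro a
  rw [hA, h a]

theorem State.HoldsSet.insert {σ : State} {A m : ℕ} {B : Finset (Fin m)} (h : σ.HoldsSet A B)
    (a : Fin m) : (σ.setInt A a 1).HoldsSet A (insert a B) := by
  intro b
  have := h b
  by_cases hb : b = a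
  · simp [hb]
  · simp [hb, this, Fin.val_inj]

theorem SPInstance.EncodedIn.congr {q : SPInstance} {σ σ' : State} (h : q.EncodedIn σ)
    (h1 : σ'.ints 1 = σ.ints 1) (h3 : σ'.ints 3 = σ.ints 3) (h5 : σ'.ints 5 = σ.ints 5)
    (h7 : σ'.ints 7 = σ.ints 7) (hr : σ'.reals 1 = σ.reals 1) : q.EncodedIn σ' where
  n_eq := by rw [h1, h.n_eq]
  m_eq := by rw [h1, h.m_eq]
  s_eq := by rw [h1, h.s_eq]
  t_eq := by rw [h1, h.t_eq]
  tail_eq a := by rw [h3, h.tail_eq]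
  head_eq a := by rw [h5, h.head_eq]
  arcs_eq := h.arcs_eq.congr h7
  cost_eq a := by rw [hr, h.cost_eq]

/-! ### Paths that follow pointers -/

/-- Following the arcs `nx` and the vertices `nv` from `u` leads to `t`, through the vertices `vs`
and the arcs `as`. -/
inductive FinGraph.Trace {n m : ℕ} (G : FinGraph n m) (o : GraphKind) (nx nv : ℕ → ℕ) (t : Fin n) :
    Fin n → List (Fin n) → List (Fin m) → Prop
  | nil : FinGraph.Trace G o nx nv t t [t] []
  | cons {u v : Fin n} {a : Fin m} {vs : List (Fin n)} {as : List (Fin m)} :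
      nx u = a → nv u = v → G.Joins o a u v → FinGraph.Trace G o nx nv t v vs as → u ∉ vs →
      FinGraph.Trace G o nx nv t u (u :: vs) (a :: as)

section Trace

variable {n m : ℕ} {G : FinGraph n m} {o : GraphKind} {nx nv nx' nv' : ℕ → ℕ} {t : Fin n}

theorem FinGraph.Trace.isPath {u : Fin n} {vs : List (Fin n)} {as : List (Fin m)}
    (h : G.Trace o nx nv t u vs as) : G.IsPath o u t vs as := by
  induction h with
  | nil => exact .nil _
  | cons _ _ hj _ hu ih => exact .cons hj ih hu

/-- Only the pointers at visited vertices matter, so setting the pointers of a newly settled vertex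
preserves the older paths. -/
theorem FinGraph.Trace.congr {u : Fin n} {vs : List (Fin n)} {as : List (Fin m)}
    (h : G.Trace o nx nv t u vs as) (hx : ∀ x ∈ vs, nx' x = nx x ∧ nv' x = nv x) :
    G.Trace o nx' nv' t u vs as := by
  induction h with
  | nil => exact .nil
  | @cons u v a vs as ha hv hj _ hu ih =>
    obtain ⟨h₁, h₂⟩ := hx u (by simp)
    exact .cons (h₁.trans ha) (h₂.trans hv) hj
      (ih fun x hx' => hx x (List.mem_cons_of_mem _ hx')) hu

/-- A path into `R` is at least as long as the best way of entering `R`. -/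
theorem FinGraph.IsPath.le_of_crossing {arcs : Finset (Fin m)} {c : Fin m → ℝ} {R : Finset (Fin n)}
    {d : Fin n → ℝ} {δ : ℝ} (hc : ∀ a ∈ arcs, 0 ≤ c a)
    (hd : ∀ u ∈ R, ∀ vs as, G.IsPath o u t vs as → (∀ a ∈ as, a ∈ arcs) → d u ≤ (as.map c).sum)
    (hδ : ∀ a x y, a ∈ arcs → G.Joins o a x y → x ∉ R → y ∈ R → δ ≤ c a + d y)
    (ht : t ∈ R) {u : Fin n} {vs : List (Fin n)} {as : List (Fin m)} (h : G.IsPath o u t vs as)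
    (has : ∀ a ∈ as, a ∈ arcs) (hu : u ∉ R) : δ ≤ (as.map c).sum := by
  induction h with
  | nil => exact absurd ht hu
  | @cons u v w a vs as hj hp _ ih =>
    have ha : a ∈ arcs := has a (by simp)
    have has' : ∀ a ∈ as, a ∈ arcs := fun a h => has a (List.mem_cons_of_mem _ h)
    rw [List.map_cons, List.sum_cons]
    -- Either the first arc enters `R`, and the rest costs at least `d v`; or it is dropped at no
    -- gain, being of nonnegative cost, and the rest still has to enter `R`.
    by_cases hv : v ∈ R
    · exact (hδ a u v ha hj hu hv).trans (add_le_add le_rfl (hd v hv _ _ hp has'))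
    · exact (ih hd ht has' hv).trans (le_add_of_nonneg_left (hc a ha))

end Trace

/-! ### The shortest path program -/

/-- Entry `0` of the array named `A`, used as a variable. -/
abbrev ivar (A : ℕ) : IExp := .get A (.const 0)

/-- Consider the arc in variable `19`, from its end in `A` to its end in `B`, as a candidate for
entering the set of settled vertices. -/
def relax (A B : ℕ) : Prog :=
  .ite (.and (.ieq (.get 7 (ivar 19)) (.const 1))
      (.and (.ieq (.get 13 (.get B (ivar 19))) (.const 1))
        (.and (.not (.ieq (.get 13 (.get A (ivar 19))) (.const 1)))
          -- Reject only if a candidate is stored and the new one is not strictly better. While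
          -- variable `21` is `0`, the stored real value is meaningless and must not decide.
          (.not (.and (.ieq (ivar 21) (.const 1))
            (.not (.rlt (.add (.get 1 (ivar 19)) (.get 3 (.get B (ivar 19))))
              (.get 5 (.const 0)))))))))
    (.seq (.setReal 5 (.const 0) (.add (.get 1 (ivar 19)) (.get 3 (.get B (ivar 19)))))
      (.seq (.setInt 21 (.const 0) (.const 1))
        (.seq (.setInt 23 (.const 0) (ivar 19))
          (.seq (.setInt 25 (.const 0) (.get A (ivar 19)))
            (.setInt 27 (.const 0) (.get B (ivar 19)))))))
    .skip

/-- Consider the arc in variable `19` in all directions in which it can be traversed. -/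
def relaxArc : GraphKind → Prog
  | .directed => relax 3 5
  | .undirected => .seq (relax 3 5) (relax 5 3)

/-- Settle one more vertex, if possible. -/
def spRound (o : GraphKind) : Prog :=
  .seq (.setInt 21 (.const 0) (.const 0))
    (.seq (forLoop 19 1 1 (relaxArc o))
      (.ite (.ieq (ivar 21) (.const 1))
        (.seq (.setInt 13 (ivar 25) (.const 1))
          (.seq (.setReal 3 (ivar 25) (.get 5 (.const 0)))
            (.seq (.setInt 15 (ivar 25) (ivar 23))
              (.setInt 17 (ivar 25) (ivar 27)))))
        .skip))

/-- Dijkstra's algorithm, from the target to the source. -/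
def spProg (o : GraphKind) : Prog :=
  .seq (forLoop 19 1 0 (.setInt 13 (ivar 19) (.const 0)))
    (.seq (forLoop 19 1 1 (.setInt 11 (ivar 19) (.const 0)))
      (.seq (.seq (.setInt 13 (.get 1 (.const 3)) (.const 1))
          (.seq (.setReal 3 (.get 1 (.const 3)) .zero) (.setInt 21 (.const 0) (.const 1))))
        (.seq (.loop (.ieq (ivar 21) (.const 1)) (spRound o))
          (.ite (.ieq (.get 13 (.get 1 (.const 2))) (.const 1))
            (.seq (.seq (.setInt 9 (.const 0) (.const 1))
                (.setInt 29 (.const 0) (.get 1 (.const 2))))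
              (.loop (.not (.ieq (ivar 29) (.get 1 (.const 3))))
                (.seq (.setInt 11 (.get 15 (ivar 29)) (.const 1))
                  (.setInt 29 (.const 0) (.get 17 (ivar 29))))))
            (.setInt 9 (.const 0) (.const 0))))))

/-- The variables describe a best one of the candidates `C`, if there are any. -/
def IsBestCandidate (q : SPInstance) (C : Fin q.m → Fin q.n → Fin q.n → Prop) (σ : State) : Prop :=
  (σ.ints 21 0 = 0 ∧ ∀ a u v, ¬ C a u v) ∨
  (σ.ints 21 0 = 1 ∧ ∃ a u v, C a u v ∧ σ.ints 23 0 = a ∧ σ.ints 25 0 = u ∧ σ.ints 27 0 = v ∧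
    σ.reals 5 0 = q.cost a + σ.reals 3 v ∧
    ∀ a' u' v', C a' u' v' → σ.reals 5 0 ≤ q.cost a' + σ.reals 3 v')

theorem IsBestCandidate.congr {q : SPInstance} {C C' : Fin q.m → Fin q.n → Fin q.n → Prop}
    {σ : State} (h : IsBestCandidate q C σ) (hC : ∀ a u v, C a u v ↔ C' a u v) :
    IsBestCandidate q C' σ := by
  obtain rfl : C = C' := by
    funext a u v
    exact propext (hC a u v)
  exact h

/-- The candidates examined so far form an arbitrary relation `C`, which one execution enlarges by
at most one triple. This form serves both directions of an edge and composes along the scan. -/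
theorem relax_wp {q : SPInstance} {A B : ℕ} (hAB : A = 3 ∧ B = 5 ∨ A = 5 ∧ B = 3) {σ : State}
    {R : Finset (Fin q.n)} (hq : q.EncodedIn σ) (hR : σ.HoldsSet 13 R) {a : Fin q.m}
    {u v : Fin q.n} (ha : σ.ints 19 0 = a) (hA : σ.ints A a = u) (hB : σ.ints B a = v)
    {C : Fin q.m → Fin q.n → Fin q.n → Prop} (h : IsBestCandidate q C σ) :
    (relax A B).wp (IsBestCandidate q fun x y z =>
      C x y z ∨ (x = a ∧ y = u ∧ z = v ∧ a ∈ q.arcs ∧ u ∉ R ∧ v ∈ R)) σ := by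
  simp only [relax, Prog.wp, BExp.Holds, IExp.eval, RExp.eval, ha, hA, hB, hq.arcs_eq a, hR u,
    hR v, hq.cost_eq a]
  refine ⟨?_, ?_⟩
  · rintro ⟨h₁, h₂, h₃, h₄⟩
    have h₁ : a ∈ q.arcs := by simpa using h₁
    have h₂ : v ∈ R := by simpa using h₂
    have h₃ : u ∉ R := by simpa using h₃
    refine Or.inr ⟨by simp, a, u, v, Or.inr ⟨rfl, rfl, rfl, h₁, h₃, h₂⟩, ?_⟩
    rcases hAB with ⟨rfl, rfl⟩ | ⟨rfl, rfl⟩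
    all_goals
      refine ⟨by simp [ha], by simp [ha, hA], by simp [ha, hB], by simp, ?_⟩
      rintro a' u' v' (hC | ⟨rfl, rfl, rfl, -⟩)
      · rcases h with ⟨-, h⟩ | ⟨h21, _, _, _, _, _, _, _, _, h⟩
        · exact absurd hC (h _ _ _)
        · have h₅ := h _ _ _ hC
          have : q.cost a + σ.reals 3 v < σ.reals 5 0 := by
            by_contra h'
            exact h₄ ⟨h21, h'⟩
          simpa using this.le.trans h₅
      · simp
  · intro hn
    rcases h with ⟨h21, h⟩ | ⟨h21, a', u', v', hC, h23, h25, h27, hb, h⟩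
    · refine Or.inl ⟨h21, ?_⟩
      rintro a' u' v' (hC | ⟨-, -, -, h₁, h₂, h₃⟩)
      · exact h _ _ _ hC
      · exact hn ⟨by simp [h₁], by simp [h₃], by simp [h₂], by simp [h21]⟩
    · refine Or.inr ⟨h21, a', u', v', Or.inl hC, h23, h25, h27, hb, ?_⟩
      rintro a'' u'' v'' (hC | ⟨rfl, rfl, rfl, h₁, h₂, h₃⟩)
      · exact h _ _ _ hC
      · by_contra hlt
        exact hn ⟨by simp [h₁], by simp [h₃], by simp [h₂], fun h' => h'.2 (not_le.1 hlt)⟩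

theorem relax_frame {A B : ℕ} :
    (∀ X, (relax A B).WritesInt X → X = 21 ∨ X = 23 ∨ X = 25 ∨ X = 27) ∧
    (∀ X, (relax A B).WritesReal X → X = 5) := by
  constructor <;> intro X <;> simp [relax, Prog.WritesInt, Prog.WritesReal]

/-- The arcs that enter `R`. -/
def SPInstance.Enters (q : SPInstance) (o : GraphKind) (R : Finset (Fin q.n)) (a : Fin q.m)
    (u v : Fin q.n) : Prop :=
  a ∈ q.arcs ∧ q.G.Joins o a u v ∧ u ∉ R ∧ v ∈ R

/-! ### One settling round of Dijkstra's algorithm -/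

section Scan

variable {sub : State → State → ℕ → Prop} {q : SPInstance} {o : GraphKind}

theorem relaxArc_writesInt {X : ℕ} (h : (relaxArc o).WritesInt X) :
    X = 21 ∨ X = 23 ∨ X = 25 ∨ X = 27 := by
  cases o
  · exact relax_frame.1 X h
  · exact h.elim (relax_frame.1 X) (relax_frame.1 X)

theorem relaxArc_writesReal {X : ℕ} (h : (relaxArc o).WritesReal X) : X = 5 := by
  cases o
  · exact relax_frame.2 X h
  · exact h.elim (relax_frame.2 X) (relax_frame.2 X)

theorem relaxArc_ensures (hsub : ∀ σ σ' t, sub σ σ' t → SameEvenArrays σ σ') {σ : State}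
    {l : List (State × ℕ)} {R : Finset (Fin q.n)} (hq : q.EncodedIn σ) (hR : σ.HoldsSet 13 R)
    {a : Fin q.m} (ha : σ.ints 19 0 = a) {C : Fin q.m → Fin q.n → Fin q.n → Prop}
    (h : IsBestCandidate q C σ) :
    Ensures sub (relaxArc o) σ l 14 fun σ' l' => l' = l ∧
      IsBestCandidate q (fun x y z => C x y z ∨ (x = a ∧ q.Enters o R x y z)) σ' := by
  cases o with
  | directed =>
    refine (Ensures.of_wp (relax_wp (Or.inl ⟨rfl, rfl⟩) hq hR ha (hq.tail_eq a)
      (hq.head_eq a) h) (by simp [relax, Prog.length])).consequence hsub le_rfl ?_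
    rintro σ' l' - ⟨rfl, h'⟩
    refine ⟨rfl, h'.congr fun x y z => or_congr_right ?_⟩
    constructor
    · rintro ⟨rfl, rfl, rfl, h₁, h₂, h₃⟩
      exact ⟨rfl, h₁, ⟨rfl, rfl⟩, h₂, h₃⟩
    · rintro ⟨rfl, h₁, ⟨rfl, rfl⟩, h₂, h₃⟩
      exact ⟨rfl, rfl, rfl, h₁, h₂, h₃⟩
  | undirected =>
    refine ((Ensures.of_wp (T := 7) (relax_wp (Or.inl ⟨rfl, rfl⟩) hq hR ha (hq.tail_eq a)
      (hq.head_eq a) h) (by simp [relax, Prog.length])).seq (T₂ := 7) hsub ?_)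
    rintro σ₁ l' hF ⟨rfl, h'⟩
    have hi : ∀ X, X ≠ 21 → X ≠ 23 → X ≠ 25 → X ≠ 27 → σ₁.ints X = σ.ints X :=
      fun X h₁ h₂ h₃ h₄ => hF.ints X fun hX => by
        rcases relax_frame.1 X hX with h | h | h | h <;> contradiction
    have hq₁ : q.EncodedIn σ₁ := hq.congr (hi _ (by simp) (by simp) (by simp) (by simp))
      (hi _ (by simp) (by simp) (by simp) (by simp)) (hi _ (by simp) (by simp) (by simp) (by simp))
      (hi _ (by simp) (by simp) (by simp) (by simp))
      (hF.reals _ fun hX => by simpa using relax_frame.2 _ hX)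
    refine (Ensures.of_wp (relax_wp (Or.inr ⟨rfl, rfl⟩) hq₁
      (hR.congr (hi _ (by simp) (by simp) (by simp) (by simp)))
      (a := a) (by rw [hi _ (by simp) (by simp) (by simp) (by simp), ha]) (hq₁.head_eq a)
      (hq₁.tail_eq a) h') (by simp [relax, Prog.length])).consequence hsub le_rfl ?_
    rintro σ' l' - ⟨rfl, h'⟩
    refine ⟨rfl, h'.congr fun x y z => ?_⟩
    rw [or_assoc]
    refine or_congr_right ?_
    constructor
    · rintro (⟨rfl, rfl, rfl, h₁, h₂, h₃⟩ | ⟨rfl, rfl, rfl, h₁, h₂, h₃⟩)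
      · exact ⟨rfl, h₁, Or.inl ⟨rfl, rfl⟩, h₂, h₃⟩
      · exact ⟨rfl, h₁, Or.inr ⟨rfl, rfl⟩, h₂, h₃⟩
    · rintro ⟨rfl, h₁, ⟨rfl, rfl⟩ | ⟨rfl, rfl⟩, h₂, h₃⟩
      · exact Or.inl ⟨rfl, rfl, rfl, h₁, h₂, h₃⟩
      · exact Or.inr ⟨rfl, rfl, rfl, h₁, h₂, h₃⟩

theorem scan_ensures (hsub : ∀ σ σ' t, sub σ σ' t → SameEvenArrays σ σ') {σ : State}
    {l : List (State × ℕ)} {R : Finset (Fin q.n)} (hq : q.EncodedIn σ) (hR : σ.HoldsSet 13 R)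
    (h21 : σ.ints 21 0 = 0) :
    Ensures sub (forLoop 19 1 1 (relaxArc o)) σ l (q.m * 16 + 2) fun σ' l' => l' = l ∧
      IsBestCandidate q (q.Enters o R) σ' := by
  have hw : ∀ X, X ≠ 19 → X ≠ 21 → X ≠ 23 → X ≠ 25 → X ≠ 27 →
      ¬ (forLoop 19 1 1 (relaxArc o)).WritesInt X := by
    rintro X h₀ h₁ h₂ h₃ h₄ (h | h | h)
    · exact h₀ h
    · rcases relaxArc_writesInt h with h | h | h | h <;> contradiction
    · exact h₀ h
  have hwr : ∀ X, X ≠ 5 → ¬ (forLoop 19 1 1 (relaxArc o)).WritesReal X := by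
    rintro X h₀ (h | h | h)
    · exact h
    · exact h₀ (relaxArc_writesReal h)
    · exact h
  refine Ensures.forLoop hsub (fun j σ' l' => l' = l ∧
    IsBestCandidate q (fun a u v => a.val < j ∧ q.Enters o R a u v) σ') hq.m_eq (by simp)
    (fun h => by rcases relaxArc_writesInt h with h | h | h | h <;> contradiction)
    (fun h => by rcases relaxArc_writesInt h with h | h | h | h <;> contradiction)
    ⟨rfl, Or.inl ⟨by simpa using h21, by simp⟩⟩ ?_ ?_
  · rintro j hj σ₁ l₁ hF h19 ⟨rfl, hb⟩
    have hi := fun X h₀ h₁ h₂ h₃ h₄ => hF.ints X (hw X h₀ h₁ h₂ h₃ h₄)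
    have hq₁ : q.EncodedIn σ₁ := hq.congr (hi _ (by simp) (by simp) (by simp) (by simp) (by simp))
      (hi _ (by simp) (by simp) (by simp) (by simp) (by simp))
      (hi _ (by simp) (by simp) (by simp) (by simp) (by simp))
      (hi _ (by simp) (by simp) (by simp) (by simp) (by simp)) (hF.reals _ (hwr _ (by simp)))
    refine (relaxArc_ensures hsub hq₁
      (hR.congr (hi _ (by simp) (by simp) (by simp) (by simp) (by simp)))
      (a := ⟨j, hj⟩) h19 hb).consequence hsub le_rfl ?_
    rintro σ' l' - ⟨rfl, h'⟩ -
    refine ⟨rfl, ?_⟩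
    have h'' := h'.congr (C' := fun a u v => a.val < j + 1 ∧ q.Enters o R a u v) fun x y z => by
      rw [← or_and_right, Nat.lt_succ_iff_lt_or_eq, Fin.ext_iff]
    simpa [IsBestCandidate] using h''
  · rintro σ' l' - ⟨rfl, h'⟩
    exact ⟨rfl, h'.congr fun a u v => by simp⟩

/-- The state of the algorithm: `R` is the set of settled vertices. -/
structure Settled (q : SPInstance) (o : GraphKind) (R : Finset (Fin q.n)) (σ : State) : Prop where
  enc : q.EncodedIn σ
  holds : σ.HoldsSet 13 R
  out : σ.HoldsSet 11 (∅ : Finset (Fin q.m))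
  mem : q.t ∈ R
  trace : ∀ u ∈ R, ∃ vs as, q.G.Trace o (σ.ints 15) (σ.ints 17) q.t u vs as ∧ (∀ v ∈ vs, v ∈ R) ∧
    (∀ a ∈ as, a ∈ q.arcs) ∧ σ.reals 3 u = (as.map q.cost).sum
  dist : ∀ u ∈ R, ∀ vs as, q.G.IsPath o u q.t vs as → (∀ a ∈ as, a ∈ q.arcs) →
    σ.reals 3 u ≤ (as.map q.cost).sum

theorem Settled.congr {R : Finset (Fin q.n)} {σ σ' : State} (h : Settled q o R σ)
    (hi : ∀ X ∈ [1, 3, 5, 7, 11, 13, 15, 17], σ'.ints X = σ.ints X)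
    (hr : ∀ X ∈ [1, 3], σ'.reals X = σ.reals X) : Settled q o R σ' where
  enc := h.enc.congr (hi _ (by simp)) (hi _ (by simp)) (hi _ (by simp)) (hi _ (by simp))
    (hr _ (by simp))
  holds := h.holds.congr (hi _ (by simp))
  out := h.out.congr (hi _ (by simp))
  mem := h.mem
  trace := by
    rw [hi 15 (by simp), hi 17 (by simp), hr 3 (by simp)]
    exact h.trace
  dist := by
    rw [hr 3 (by simp)]
    exact h.dist

/-- Dijkstra's step: a path from the new vertex `u` starts outside `R` and must enter it, so it
costs at least as much as the best entering arc followed by a shortest path from its head; the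
pointers of `u` attain this value. -/
theorem Settled.insert {R : Finset (Fin q.n)} {σ σ' : State} (h : Settled q o R σ) {a : Fin q.m}
    {u v : Fin q.n} (ha : q.Enters o R a u v)
    (hi : ∀ X ∈ [1, 3, 5, 7, 11], σ'.ints X = σ.ints X) (hr : σ'.reals 1 = σ.reals 1)
    (h13 : σ'.HoldsSet 13 (insert u R))
    (h15 : ∀ x : Fin q.n, σ'.ints 15 x = if x = u then a.val else σ.ints 15 x)
    (h17 : ∀ x : Fin q.n, σ'.ints 17 x = if x = u then v.val else σ.ints 17 x)
    (h3 : ∀ x : Fin q.n, σ'.reals 3 x = if x = u then q.cost a + σ.reals 3 v else σ.reals 3 x)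
    (hbest : ∀ a' u' v', q.Enters o R a' u' v' →
      q.cost a + σ.reals 3 v ≤ q.cost a' + σ.reals 3 v') : Settled q o (insert u R) σ' where
  enc := h.enc.congr (hi _ (by simp)) (hi _ (by simp)) (hi _ (by simp)) (hi _ (by simp)) hr
  holds := h13
  out := h.out.congr (hi _ (by simp))
  mem := Finset.mem_insert_of_mem h.mem
  trace := by
    obtain ⟨ha₁, ha₂, hu, hv⟩ := ha
    -- The older pointer paths stay inside `R`, so they avoid `u`, the only vertex whose pointers
    -- changed.
    have key : ∀ x ∈ R, ∃ vs as, q.G.Trace o (σ'.ints 15) (σ'.ints 17) q.t x vs as ∧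
        (∀ v ∈ vs, v ∈ R) ∧ (∀ a ∈ as, a ∈ q.arcs) ∧ σ.reals 3 x = (as.map q.cost).sum := by
      intro x hx
      obtain ⟨vs, as, hT, hvs, has, hsum⟩ := h.trace x hx
      refine ⟨vs, as, hT.congr fun y hy => ?_, hvs, has, hsum⟩
      have hyu : y ≠ u := fun hyu => hu (hyu ▸ hvs y hy)
      simp [h15, h17, hyu]
    intro x hx
    rcases Finset.mem_insert.1 hx with rfl | hx
    · obtain ⟨vs, as, hT, hvs, has, hsum⟩ := key v hv
      refine ⟨x :: vs, a :: as, .cons (by simp [h15]) (by simp [h17]) ha₂ hT fun hx => hu (hvs _ hx),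
        ?_, ?_, by simp [h3, hsum]⟩
      · exact fun y hy => (List.mem_cons.1 hy).elim (fun hy => hy ▸ Finset.mem_insert_self _ _)
          fun hy => Finset.mem_insert_of_mem (hvs y hy)
      · exact fun y hy => (List.mem_cons.1 hy).elim (fun hy => hy ▸ ha₁) fun hy => has y hy
    · obtain ⟨vs, as, hT, hvs, has, hsum⟩ := key x hx
      refine ⟨vs, as, hT, fun y hy => Finset.mem_insert_of_mem (hvs y hy), has, ?_⟩
      have hxu : x ≠ u := fun hxu => hu (hxu ▸ hx)
      simp [h3, hxu, hsum]
  dist := by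
    intro x hx vs as hp has
    rw [h3]
    split_ifs with hxu
    · subst hxu
      exact hp.le_of_crossing q.cost_nonneg (d := fun y => σ.reals 3 y) h.dist
        (fun a' x y h₁ h₂ h₃ h₄ => hbest a' x y ⟨h₁, h₂, h₃, h₄⟩) h.mem has ha.2.2.1
    · exact h.dist x ((Finset.mem_insert.1 hx).resolve_left hxu) vs as hp has

theorem spRound_ensures (hsub : ∀ σ σ' t, sub σ σ' t → SameEvenArrays σ σ') {σ : State}
    {l : List (State × ℕ)} {R : Finset (Fin q.n)} (h : Settled q o R σ) :
    Ensures sub (spRound o) σ l (q.m * 16 + 9) fun σ' l' => l' = l ∧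
      ((σ'.ints 21 0 = 0 ∧ Settled q o R σ' ∧ ∀ a u v, ¬ q.Enters o R a u v) ∨
        (σ'.ints 21 0 = 1 ∧ ∃ u ∉ R, Settled q o (insert u R) σ')) := by
  refine (Ensures.seq (T₁ := 1) (T₂ := q.m * 16 + 2 + 6) (Q₁ := fun σ₁ l₁ => l₁ = l ∧
    σ₁ = σ.setInt 21 0 0) (.of_wp ?_ ?_) hsub ?_).le (by omega)
  · simp [Prog.wp, IExp.eval]
  · simp [Prog.length]
  rintro _ _ - ⟨rfl, rfl⟩
  have h₁ : Settled q o R (σ.setInt 21 0 0) := h.congr (by simp [State.setInt]) (by simp)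
  refine Ensures.seq ((scan_ensures hsub h₁.enc h₁.holds (by simp))) hsub ?_
  rintro σ₁ _ hF ⟨rfl, hb⟩
  have h₂ : Settled q o R σ₁ := by
    refine h₁.congr (fun X hX => hF.ints X ?_) (fun X hX => hF.reals X ?_)
    · simp only [List.mem_cons, List.not_mem_nil, or_false] at hX
      rintro (h | h | h)
      · simp only [Prog.WritesInt] at h; omega
      · have := relaxArc_writesInt h; omega
      · simp only [Prog.WritesInt] at h; omega
    · simp only [List.mem_cons, List.not_mem_nil, or_false] at hX
      rintro (h | h | h)
      · exact h
      · have := relaxArc_writesReal h; omega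
      · exact h
  refine .of_wp ?_ (by simp [Prog.length])
  simp only [Prog.wp, BExp.Holds, IExp.eval, RExp.eval]
  refine ⟨fun h21 => Or.inr ?_, fun h21 => Or.inl ?_⟩
  · rcases hb with ⟨h21', -⟩ | ⟨-, a, u, v, ha, h23, h25, h27, hd, hb⟩
    · omega
    · refine ⟨by simpa using h21, u, ha.2.2.1, h₂.insert ha ?_ ?_ ?_ ?_ ?_ ?_ ?_⟩
      · simp [State.setInt, State.setReal]
      · simp [State.setReal]
      · rw [h25]
        exact (h₂.holds.insert u).congr (by simp [State.setInt])
      · simp [h25, h23, Fin.val_inj]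
      · simp [h25, h27, Fin.val_inj]
      · simp [h25, hd, Fin.val_inj]
      · rwa [hd] at hb
  · rcases hb with ⟨h21', hb⟩ | ⟨h21', -⟩
    · exact ⟨h21', h₂, hb⟩
    · exact absurd h21' h21

end Scan

/-! ### Dijkstra's algorithm as a whole -/

section ShortestPath

variable {sub : State → State → ℕ → Prop} {q : SPInstance} {o : GraphKind}

theorem clear_ensures (hsub : ∀ σ σ' t, sub σ σ' t → SameEvenArrays σ σ') {σ : State}
    {l : List (State × ℕ)} {A c N : ℕ} (hN : σ.ints 1 c = N) (hA : A ≠ 1) (hA' : A ≠ 19) :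
    Ensures sub (forLoop 19 1 c (.setInt A (ivar 19) (.const 0))) σ l (N * 3 + 2) fun σ' l' =>
      l' = l ∧ σ'.HoldsSet A (∅ : Finset (Fin N)) := by
  refine Ensures.forLoop hsub (fun j σ' l' => l' = l ∧ ∀ b < j, σ'.ints A b = 0) hN (by simp)
    (fun h => hA h.symm) (fun h => hA' h.symm) ⟨rfl, by simp⟩ ?_ ?_
  · rintro j hj σ₁ l₁ - h19 ⟨rfl, hb⟩
    refine (Ensures.of_wp (Q := fun σ' => ∀ b < j + 1, σ'.ints A b = 0) ?_
      (by simp [Prog.length])).consequence hsub le_rfl ?_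
    · intro b hb'
      simp only [IExp.eval, h19, State.ints_setInt]
      split_ifs with h
      · rfl
      · have hbj : b ≠ j := fun hbj => h ⟨trivial, hbj⟩
        exact hb b (by omega)
    · rintro σ' l' - ⟨rfl, h⟩ -
      exact ⟨rfl, fun b hb' => by rw [State.ints_setInt_of_ne _ _ _ hA']; exact h b hb'⟩
  · rintro σ' l' - ⟨rfl, h⟩
    exact ⟨rfl, fun a => by simpa using h a a.isLt⟩

theorem spLoop_ensures (hsub : ∀ σ σ' t, sub σ σ' t → SameEvenArrays σ σ') {σ : State}
    {l : List (State × ℕ)} (h : Settled q o {q.t} σ) (h21 : σ.ints 21 0 = 1) :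
    Ensures sub (.loop (.ieq (ivar 21) (.const 1)) (spRound o)) σ l
      (q.n * (q.m * 16 + 9 + 1) + 1) fun σ' l' => l' = l ∧
        ∃ R, Settled q o R σ' ∧ ∀ a u v, ¬ q.Enters o R a u v := by
  -- As long as the flag is `1`, the index is `q.n + 1 - R.card`: it starts at `q.n` because `t` is
  -- settled, and it stays positive, which leaves room for the last round, the one that settles
  -- nothing.
  refine Ensures.loop (fun j σ' l' => l' = l ∧ ∃ R, Settled q o R σ' ∧
    ((σ'.ints 21 0 = 1 ∧ R.card + j = q.n + 1) ∨
      (σ'.ints 21 0 = 0 ∧ ∀ a u v, ¬ q.Enters o R a u v))) q.n σ l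
      ⟨rfl, _, h, Or.inl ⟨h21, by simp; omega⟩⟩ ?_ ?_
  · rintro j σ₁ l₁ ⟨rfl, R, hS, hR⟩ hb
    rcases hR with ⟨-, hR⟩ | ⟨h0, -⟩
    · have hcard : R.card ≤ q.n := by simpa using R.card_le_univ
      refine ⟨j - 1, by omega, (spRound_ensures hsub hS).consequence hsub le_rfl ?_⟩
      rintro σ' l' - ⟨rfl, ⟨h0, hS', hc⟩ | ⟨h1, u, hu, hS'⟩⟩
      · exact ⟨rfl, R, hS', Or.inr ⟨h0, hc⟩⟩
      · exact ⟨rfl, _, hS', Or.inl ⟨h1, by rw [Finset.card_insert_of_notMem hu]; omega⟩⟩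
    · simp [BExp.Holds, IExp.eval, h0] at hb
  · rintro j σ₁ l₁ ⟨rfl, R, hS, hR⟩ hb
    rcases hR with ⟨h1, -⟩ | ⟨-, hc⟩
    · simp [BExp.Holds, IExp.eval, h1] at hb
    · exact ⟨rfl, R, hS, hc⟩

theorem trace_ensures {σ : State}
    {l : List (State × ℕ)} (ht : σ.ints 1 3 = q.t) {u : Fin q.n} {vs : List (Fin q.n)}
    {as : List (Fin q.m)} (hT : q.G.Trace o (σ.ints 15) (σ.ints 17) q.t u vs as)
    (hu : σ.ints 29 0 = u) (hout : σ.HoldsSet 11 (∅ : Finset (Fin q.m))) :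
    Ensures sub (.loop (.not (.ieq (ivar 29) (.get 1 (.const 3))))
        (.seq (.setInt 11 (.get 15 (ivar 29)) (.const 1))
          (.setInt 29 (.const 0) (.get 17 (ivar 29))))) σ l (q.n * 3 + 1)
      fun σ' l' => l' = l ∧ σ'.HoldsSet 11 as.toFinset := by
  -- The index is the length of the path still to be followed, and `D` is the part already written;
  -- together they always make up the whole path.
  refine (Ensures.loop (Tb := 2) (fun j σ' l' => l' = l ∧ σ'.ints 15 = σ.ints 15 ∧
    σ'.ints 17 = σ.ints 17 ∧ σ'.ints 1 3 = q.t ∧ ∃ x vs' as' D, σ'.ints 29 0 = x.val ∧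
      q.G.Trace o (σ.ints 15) (σ.ints 17) q.t x vs' as' ∧ as'.length = j ∧ σ'.HoldsSet 11 D ∧
      D ∪ as'.toFinset = as.toFinset) as.length σ l
      ⟨rfl, rfl, rfl, ht, u, vs, as, ∅, hu, hT, rfl, hout, by simp⟩ ?_ ?_).le ?_
  · rintro j σ₁ l₁ ⟨rfl, h15, h17, ht, x, vs', as', D, hx, hT', hj, hD, hU⟩ hb
    cases hT' with
    | nil => simp [BExp.Holds, IExp.eval, ht, hx] at hb
    | @cons _ y a vs' as' ha hy hJ hT' hxv =>
      refine ⟨as'.length, by simp [← hj], .of_wp ?_ (by simp [Prog.length])⟩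
      simp only [Prog.wp, IExp.eval, hx, h15, ha]
      refine ⟨by simp [State.setInt, h15], by simp [State.setInt, h17], by simp [ht], y, vs', as',
        insert a D, ?_, hT', rfl, ?_, ?_⟩
      · simp [hx, h17, hy]
      · exact (hD.insert a).congr (by simp [State.setInt])
      · rw [← hU]
        ext z
        simp only [Finset.mem_union, Finset.mem_insert, List.mem_toFinset, List.mem_cons]
        tauto
  · rintro j σ₁ l₁ ⟨rfl, h15, h17, ht, x, vs', as', D, hx, hT', hj, hD, hU⟩ hb
    have hxt : x = q.t := by simpa [BExp.Holds, IExp.eval, ht, hx, Fin.val_inj] using hb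
    cases hT' with
    | nil =>
      obtain rfl : D = as.toFinset := by simpa using hU
      exact ⟨rfl, hD⟩
    | cons _ _ _ hT' hxv => exact absurd (hxt ▸ hT'.isPath.end_mem) hxv
  · have := hT.isPath.length_lt
    nlinarith

theorem Settled.isShortest {R : Finset (Fin q.n)} {σ : State} (h : Settled q o R σ) {u : Fin q.n}
    (hs : u = q.s) (hu : u ∈ R) {vs : List (Fin q.n)} {as : List (Fin q.m)}
    (hp : q.G.IsPath o u q.t vs as) (has : ∀ a ∈ as, a ∈ q.arcs)
    (hsum : σ.reals 3 u = (as.map q.cost).sum) : q.IsShortest o as.toFinset := by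
  subst hs
  refine ⟨⟨⟨vs, as, hp, rfl⟩, fun a ha => has a (by simpa using ha)⟩, ?_⟩
  rintro P' ⟨⟨vs', as', hp', rfl⟩, hP'⟩
  rw [hp.sum_toFinset, hp'.sum_toFinset, ← hsum]
  exact h.dist _ hu _ _ hp' fun a ha => hP' (by simpa using ha)

theorem Settled.source_mem {R : Finset (Fin q.n)} {σ : State} (h : Settled q o R σ)
    (hR : ∀ a u v, ¬ q.Enters o R a u v) {P : Finset (Fin q.m)} (hP : q.Feasible o P) :
    q.s ∈ R := by
  obtain ⟨⟨vs, as, hp, rfl⟩, has⟩ := hP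
  by_contra hs
  -- No arc enters `R`, so every `δ` bounds the entering arcs vacuously; one exceeding the length of
  -- the path itself is absurd.
  have := hp.le_of_crossing (δ := (as.map q.cost).sum + 1) q.cost_nonneg h.dist
    (fun a x y h₁ h₂ h₃ h₄ => absurd ⟨h₁, h₂, h₃, h₄⟩ (hR a x y)) h.mem
    (fun a ha => has (by simpa using ha)) hs
  linarith

theorem spProg_ensures (hsub : ∀ σ σ' t, sub σ σ' t → SameEvenArrays σ σ') {σ : State}
    {l : List (State × ℕ)} (h : q.EncodedIn σ) :
    Ensures sub (spProg o) σ l (20 * (q.n + q.m + 1) ^ 2) fun σ' l' =>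
      l' = l ∧ q.SolvedIn o σ' := by
  refine (((clear_ensures hsub h.n_eq (by simp) (by simp)).seq
    (T₂ := q.m * 3 + 2 + (3 + (q.n * (q.m * 16 + 9 + 1) + 1 + (2 + (q.n * 3 + 1) + 1))))
    hsub ?_).le (by ring_nf; nlinarith))
  rintro σ₁ _ hF₁ ⟨rfl, h13⟩
  have h₁ : q.EncodedIn σ₁ := h.congr (hF₁.ints _ (by simp [forLoop, Prog.WritesInt]))
    (hF₁.ints _ (by simp [forLoop, Prog.WritesInt])) (hF₁.ints _ (by simp [forLoop, Prog.WritesInt]))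
    (hF₁.ints _ (by simp [forLoop, Prog.WritesInt]))
    (hF₁.reals _ (by simp [forLoop, Prog.WritesReal]))
  refine (clear_ensures hsub h₁.m_eq (by simp) (by simp)).seq hsub ?_
  rintro σ₂ _ hF₂ ⟨rfl, h11⟩
  have h₂ : q.EncodedIn σ₂ := h₁.congr (hF₂.ints _ (by simp [forLoop, Prog.WritesInt]))
    (hF₂.ints _ (by simp [forLoop, Prog.WritesInt])) (hF₂.ints _ (by simp [forLoop, Prog.WritesInt]))
    (hF₂.ints _ (by simp [forLoop, Prog.WritesInt]))
    (hF₂.reals _ (by simp [forLoop, Prog.WritesReal]))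
  replace h13 := h13.congr (hF₂.ints 13 (by simp [forLoop, Prog.WritesInt]))
  refine (Ensures.of_wp (Q := fun σ' => Settled q o {q.t} σ' ∧ σ'.ints 21 0 = 1) ?_
    (by simp [Prog.length])).seq hsub ?_
  · simp only [Prog.wp, IExp.eval, RExp.eval, h₂.t_eq]
    refine ⟨⟨h₂.congr ?_ ?_ ?_ ?_ ?_, ?_, h11.congr ?_, by simp, ?_, ?_⟩, by simp⟩
    · simp [State.setInt, State.setReal]
    · simp [State.setInt, State.setReal]
    · simp [State.setInt, State.setReal]
    · simp [State.setInt, State.setReal]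
    · simp [State.setInt, State.setReal, h₂.t_eq]
    · exact (h13.insert q.t).congr (by simp [State.setInt, State.setReal])
    · simp [State.setInt, State.setReal]
    · intro u hu
      obtain rfl := Finset.mem_singleton.1 hu
      exact ⟨_, _, .nil, by simp, by simp, by simp [h₂.t_eq]⟩
    · intro u hu vs as hp has
      obtain rfl := Finset.mem_singleton.1 hu
      -- A path from `t` to itself has no arcs, since its vertices are distinct; thus the initial
      -- distance `0` is right.
      cases hp with
      | nil => simp [h₂.t_eq]
      | cons _ hp hn => exact absurd hp.end_mem hn
  rintro σ₃ _ - ⟨rfl, h₃, h21⟩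
  refine (spLoop_ensures hsub h₃ h21).seq hsub ?_
  rintro σ₄ _ - ⟨rfl, R, h₄, hR⟩
  refine Ensures.ite (fun hb => ?_) (fun hb => ?_)
  · have hs : q.s ∈ R := by
      simpa [BExp.Holds, IExp.eval, h₄.enc.s_eq, h₄.holds q.s] using hb
    obtain ⟨vs, as, hT, -, has, hsum⟩ := h₄.trace _ hs
    have hshort := h₄.isShortest rfl hs hT.isPath has hsum
    refine (Ensures.of_wp (T := 2) (Q := fun σ' => σ' = (σ₄.setInt 9 0 1).setInt 29 0 q.s) ?_
      (by simp [Prog.length])).seq hsub ?_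
    · simp [Prog.wp, IExp.eval, h₄.enc.s_eq]
    · rintro _ _ - ⟨rfl, rfl⟩
      refine (trace_ensures (σ := (σ₄.setInt 9 0 1).setInt 29 0 q.s) (by simp [h₄.enc.t_eq]) hT
        (by simp) (h₄.out.congr (by simp [State.setInt]))).consequence hsub le_rfl ?_
      rintro σ' l' hF ⟨rfl, h⟩
      refine ⟨rfl, Or.inl ⟨?_, _, hshort, h⟩⟩
      rw [hF.ints 9 (by simp [Prog.WritesInt])]
      simp
  · have hs : q.s ∉ R := by
      simpa [BExp.Holds, IExp.eval, h₄.enc.s_eq, h₄.holds q.s] using hb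
    refine (Ensures.of_wp (T := 1) (Q := fun σ' => σ'.ints 9 0 = 0) ?_
      (by simp [Prog.length])).consequence hsub (by omega) ?_
    · simp [Prog.wp, IExp.eval]
    · rintro σ' l' - ⟨rfl, h9⟩
      exact ⟨rfl, Or.inr ⟨h9, fun ⟨P, hP⟩ => hs (h₄.source_mem hR hP)⟩⟩

theorem spProg_runs {σ : State} (h : q.EncodedIn σ) :
    ∃ σ' t, Runs (spProg o) σ σ' t ∧ t ≤ 20 * (q.n + q.m + 1) ^ 2 ∧ q.SolvedIn o σ' ∧
      SameEvenArrays σ σ' := by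
  obtain ⟨σ', t, c, he, ht, hc, hs⟩ := spProg_ensures (sub := fun _ _ _ => False) (o := o) (l := [])
    (fun _ _ _ h => h.elim) h
  obtain rfl : c = [] := by simpa using hc
  have hF := he.frame fun _ _ _ h => h.elim
  refine ⟨σ', t, he, by simpa using ht, hs, fun A hA => ⟨hF.ints A fun hw => ?_,
    hF.reals A fun hw => ?_⟩⟩
  · have : A = 9 ∨ A = 11 ∨ A = 13 ∨ A = 15 ∨ A = 17 ∨ A = 19 ∨ A = 21 ∨ A = 23 ∨ A = 25 ∨ A = 27 ∨
        A = 29 := by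
      simp only [spProg, spRound, forLoop, Prog.WritesInt] at hw
      have := @relaxArc_writesInt o A
      tauto
    rw [Nat.even_iff] at hA
    omega
  · have : A = 3 ∨ A = 5 := by
      simp only [spProg, spRound, forLoop, Prog.WritesReal] at hw
      have := @relaxArc_writesReal o A
      tauto
    rw [Nat.even_iff] at hA
    omega

end ShortestPath

theorem isShortestPathAlgorithm_spProg (o : GraphKind) : IsShortestPathAlgorithm o (spProg o) := by
  intro q σ h
  obtain ⟨σ', t, h₁, -, h₂, h₃⟩ := spProg_runs (o := o) h
  exact ⟨σ', t, h₁, h₂, h₃⟩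

theorem isPolynomialTime_spProg (o : GraphKind) : IsPolynomialTime (spProg o) := by
  refine ⟨20 * (Polynomial.X + 1) ^ 2, fun q σ h => ?_⟩
  obtain ⟨σ', t, h₁, h₂, -⟩ := spProg_runs (o := o) h
  exact ⟨σ', t, h₁, by simpa using h₂⟩

/-! ### Optimality -/

section Optimality

variable {o : GraphKind} (I : Instance o)

/-- The union of the paths `P i`, together with all arcs of negative cost. -/
noncomputable def Instance.union (P : Fin I.k → Finset (Fin I.m)) : Finset (Fin I.m) :=
  Finset.univ.biUnion P ∪ Finset.univ.filter fun a => I.cost a < 0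

variable {I}

theorem sum_biUnion_le_sum {ι α : Type*} [DecidableEq ι] [DecidableEq α] (s : Finset ι)
    (P : ι → Finset α) {f : α → ℝ} (hf : ∀ a, 0 ≤ f a) :
    ∑ a ∈ s.biUnion P, f a ≤ ∑ i ∈ s, ∑ a ∈ P i, f a := by
  induction s using Finset.induction_on with
  | empty => simp
  | insert i s hi ih =>
    rw [Finset.biUnion_insert, Finset.sum_insert hi]
    have h₁ := Finset.sum_union_inter (s₁ := P i) (s₂ := s.biUnion P) (f := f)
    have h₂ : 0 ≤ ∑ a ∈ P i ∩ s.biUnion P, f a := Finset.sum_nonneg fun a _ => hf a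
    linarith

theorem Instance.sum_union_le {B : Finset (Fin I.m)} (hB : I.Feasible B)
    {P : Fin I.k → Finset (Fin I.m)}
    (hP : ∀ i, (I.query (I.multicolored ∩ B) i).IsShortest o (P i)) :
    ∑ a ∈ I.union P, I.cost a ≤ ∑ a ∈ B, I.cost a := by
  choose Q hQ hQB using hB
  set F := I.multicolored ∩ B with hF
  set c : Fin I.m → ℝ := fun a => max (I.cost a) 0 with hc
  set d : Fin I.m → ℝ := fun a => min (I.cost a) 0 with hd
  have hcd : ∀ a, I.cost a = c a + d a := fun a => by
    have := max_add_min (I.cost a) 0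
    simp only [hc, hd]
    linarith
  have hc0 : ∀ a, 0 ≤ c a := fun a => le_max_right _ _
  have hd0 : ∀ a, d a ≤ 0 := fun a => min_le_right _ _
  set cF : Fin I.m → ℝ := fun a => if a ∈ F then 0 else c a with hcF
  have hcF0 : ∀ a, 0 ≤ cF a := fun a => by
    simp only [hcF]
    split_ifs
    exacts [le_rfl, hc0 a]
  -- The union contains all arcs with `d a < 0`, so its `d`-value is the least that any set can
  -- have.
  have hneg : ∑ a ∈ I.union P, d a ≤ ∑ a ∈ B, d a := by
    have h₁ : ∑ a ∈ I.union P, d a = ∑ a, d a := by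
      refine Finset.sum_subset (Finset.subset_univ _) fun a _ ha => ?_
      have : ¬ I.cost a < 0 := fun h => ha (by simp [Instance.union, h])
      exact min_eq_right (not_lt.1 this)
    rw [h₁, ← Finset.sum_sdiff (Finset.subset_univ B)]
    have : ∑ a ∈ Finset.univ \ B, d a ≤ 0 := Finset.sum_nonpos fun a _ => hd0 a
    linarith
  have hpos : ∑ a ∈ I.union P, c a ≤ ∑ a ∈ B, c a := by
    have hFB : F ⊆ B := Finset.inter_subset_right
    have h₁ : ∑ a ∈ I.union P, c a = ∑ a ∈ Finset.univ.biUnion P, c a := by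
      refine (Finset.sum_subset Finset.subset_union_left fun a ha ha' => ?_).symm
      have : I.cost a < 0 := by simpa [ha'] using Finset.mem_union.1 ha
      exact max_eq_right this.le
    -- Arcs of `F` are paid for at most once in the union, however many paths use them; the rest is
    -- charged at the modified cost.
    have h₂ : ∑ a ∈ Finset.univ.biUnion P, c a ≤
        ∑ a ∈ F, c a + ∑ a ∈ Finset.univ.biUnion P, cF a := by
      have : ∑ a ∈ F, c a = ∑ a, if a ∈ F then c a else 0 := by simp
      have h' : ∑ a ∈ Finset.univ.biUnion P, (if a ∈ F then c a else 0) ≤ ∑ a ∈ F, c a := by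
        rw [this]
        refine Finset.sum_le_sum_of_subset_of_nonneg (Finset.subset_univ _) fun a _ _ => ?_
        split_ifs
        exacts [hc0 a, le_rfl]
      refine le_trans (le_of_eq ?_) (add_le_add h' le_rfl)
      rw [← Finset.sum_add_distrib]
      refine Finset.sum_congr rfl fun a _ => ?_
      by_cases ha : a ∈ F <;> simp [hcF, ha]
    have h₃ := sum_biUnion_le_sum Finset.univ P hcF0
    have h₄ : ∀ i, ∑ a ∈ P i, cF a ≤ ∑ a ∈ Q i \ F, c a := fun i => by
      -- The path `Q i` inside `B` competes with the shortest path `P i`; the modified cost ignores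
      -- its arcs in `F`.
      have := (hP i).2 (Q i) ⟨hQ i, (hQB i).trans Finset.inter_subset_right⟩
      refine le_trans this (le_of_eq ?_)
      rw [← Finset.filter_notMem_eq_sdiff, Finset.sum_filter]
      refine Finset.sum_congr rfl fun a _ => ?_
      simp [Instance.query, hc]
    -- An arc common to `Q i` and `Q j` has both colors and lies in `B`, hence belongs to `F`.
    have hdisj : Set.PairwiseDisjoint (Finset.univ : Finset (Fin I.k)) fun i => Q i \ F := by
      intro i _ j _ hij
      refine Finset.disjoint_left.2 fun a hi hj => ?_
      rw [Finset.mem_sdiff] at hi hj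
      have hi' := Finset.mem_inter.1 (hQB i hi.1)
      have hj' := Finset.mem_inter.1 (hQB j hj.1)
      exact hi.2 (Finset.mem_inter.2 ⟨Finset.mem_filter.2 ⟨Finset.mem_univ _, i, j, hij, hi'.2,
        hj'.2⟩, hi'.1⟩)
    have h₅ : ∑ i, ∑ a ∈ Q i \ F, c a ≤ ∑ a ∈ B \ F, c a := by
      rw [← Finset.sum_biUnion hdisj]
      refine Finset.sum_le_sum_of_subset_of_nonneg ?_ fun a _ _ => hc0 a
      refine Finset.biUnion_subset.2 fun i _ => Finset.sdiff_subset_sdiff ?_ le_rfl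
      exact (hQB i).trans Finset.inter_subset_left
    have h₆ := Finset.sum_le_sum fun i (_ : i ∈ Finset.univ) => h₄ i
    have h₇ := Finset.sum_sdiff hFB (f := c)
    linarith
  simp only [hcd, Finset.sum_add_distrib]
  linarith

theorem Instance.feasible_union {F : Finset (Fin I.m)} {P : Fin I.k → Finset (Fin I.m)}
    (hP : ∀ i, (I.query F i).IsShortest o (P i)) : I.Feasible (I.union P) := fun i =>
  ⟨P i, (hP i).1.1, Finset.subset_inter
    ((Finset.subset_biUnion_of_mem P (Finset.mem_univ i)).trans Finset.subset_union_left)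
    (hP i).1.2⟩

end Optimality

/-! ### Binary counting on subsets -/

section Counting

variable {m : ℕ} (F : Finset (Fin m))

/-- `2` to the number of elements of `F` below `j`. -/
def weight (j : ℕ) : ℕ := 2 ^ (F.filter fun b => b.val < j).card

/-- The rank of a subset of `F`. -/
def rank (S : Finset (Fin m)) : ℕ := ∑ a ∈ S, weight F a

variable {F}

theorem filter_val_lt_succ (a : Fin m) : (F.filter fun b => b.val < a.val + 1) =
    if a ∈ F then insert a (F.filter fun b => b.val < a.val) else
      F.filter fun b => b.val < a.val := by
  ext b
  split_ifs with ha
  · simp only [Finset.mem_filter, Finset.mem_insert, Nat.lt_succ_iff_lt_or_eq, Fin.val_inj]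
    constructor
    · rintro ⟨h, h' | rfl⟩ <;> simp [*]
    · rintro (rfl | ⟨h, h'⟩) <;> simp [*]
  · simp only [Finset.mem_filter, Nat.lt_succ_iff_lt_or_eq, Fin.val_inj]
    constructor
    · rintro ⟨h, h' | rfl⟩
      · exact ⟨h, h'⟩
      · exact absurd h ha
    · exact fun h => ⟨h.1, Or.inl h.2⟩

theorem weight_succ_of_mem {a : Fin m} (ha : a ∈ F) : weight F (a + 1) = 2 * weight F a := by
  rw [weight, filter_val_lt_succ, if_pos ha, Finset.card_insert_of_notMem (by simp), pow_succ,
    mul_comm, weight]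

theorem weight_succ_of_notMem {a : Fin m} (ha : a ∉ F) : weight F (a + 1) = weight F a := by
  rw [weight, filter_val_lt_succ, if_neg ha, weight]

theorem weight_zero : weight F 0 = 1 := by simp [weight]

theorem weight_card : weight F m = 2 ^ F.card := by simp [weight]

/-- The geometric sum 1 + 2 + ⋯ + 2^(r-1) = 2^r - 1. For `j = m` it gives the largest rank, that of
`F` itself. -/
theorem rank_filter_add_one {j : ℕ} (hj : j ≤ m) :
    rank F (F.filter fun b => b.val < j) + 1 = weight F j := by
  induction j with
  | zero => simp [rank, weight_zero]
  | succ j ih =>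
    have ih := ih (by omega)
    have hs := filter_val_lt_succ (F := F) ⟨j, hj⟩
    by_cases ha : ⟨j, hj⟩ ∈ F
    · rw [if_pos ha] at hs
      have hw := weight_succ_of_mem ha
      simp only at hs hw
      rw [hs, hw, rank, Finset.sum_insert (by simp)]
      rw [rank] at ih
      simp only
      omega
    · rw [if_neg ha] at hs
      have hw := weight_succ_of_notMem ha
      simp only at hs hw
      rw [hs, hw, ih]

theorem rank_lt {S : Finset (Fin m)} (hS : S ⊆ F) : rank F S < 2 ^ F.card := by
  have h₁ := rank_filter_add_one (F := F) (le_refl m)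
  rw [weight_card] at h₁
  have h₂ : rank F S ≤ rank F F := Finset.sum_le_sum_of_subset hS
  simp only [Fin.is_lt, Finset.filter_true] at h₁
  omega

end Counting

/-! ### The main program -/

/-- With this, the frame conditions of the concrete programs below are settled by `decide`. -/
instance Prog.decidableWritesInt : ∀ (p : Prog) (A : ℕ), Decidable (p.WritesInt A)
  | .skip, _ => inferInstanceAs (Decidable False)
  | .setInt B _ _, A => inferInstanceAs (Decidable (A = B))
  | .setReal _ _ _, _ => inferInstanceAs (Decidable False)
  | .seq p q, A =>
    @instDecidableOr _ _ (Prog.decidableWritesInt p A) (Prog.decidableWritesInt q A)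
  | .ite _ p q, A =>
    @instDecidableOr _ _ (Prog.decidableWritesInt p A) (Prog.decidableWritesInt q A)
  | .loop _ p, A => Prog.decidableWritesInt p A
  | .call, A => inferInstanceAs (Decidable (¬ Even A))

instance Prog.decidableWritesReal : ∀ (p : Prog) (A : ℕ), Decidable (p.WritesReal A)
  | .skip, _ => inferInstanceAs (Decidable False)
  | .setInt _ _ _, _ => inferInstanceAs (Decidable False)
  | .setReal B _ _, A => inferInstanceAs (Decidable (A = B))
  | .seq p q, A =>
    @instDecidableOr _ _ (Prog.decidableWritesReal p A) (Prog.decidableWritesReal q A)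
  | .ite _ p q, A =>
    @instDecidableOr _ _ (Prog.decidableWritesReal p A) (Prog.decidableWritesReal q A)
  | .loop _ p, A => Prog.decidableWritesReal p A
  | .call, A => inferInstanceAs (Decidable (¬ Even A))

/-- Count the classes that contain the arc in variable `18`. -/
def countColors : Prog :=
  forLoop 20 0 2 (.seq (.setInt 22 (.const 0) (.add (ivar 22) (.get 6 (ivar 24))))
    (.setInt 24 (.const 0) (.add (ivar 24) (.get 0 (.const 1)))))

/-- Compute the set of multi-colored arcs in array `12`, and the empty set in array `14`. -/
def findMulticolored : Prog :=
  forLoop 18 0 1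
    (.seq (.seq (.setInt 22 (.const 0) (.const 0)) (.setInt 24 (.const 0) (ivar 18)))
      (.seq countColors
        (.seq (.ite (.ilt (.const 1) (ivar 22)) (.setInt 12 (ivar 18) (.const 1))
            (.setInt 12 (ivar 18) (.const 0)))
          (.setInt 14 (ivar 18) (.const 0)))))

/-- Start array `16` with the set of arcs of negative cost. -/
def startUnion : Prog :=
  forLoop 20 0 1 (.ite (.rlt (.get 0 (ivar 20)) .zero) (.setInt 16 (ivar 20) (.const 1))
    (.setInt 16 (ivar 20) (.const 0)))

/-- Prepare the input of the subroutine for the color in variable `18`; variable `24` points to the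
color class. -/
def loadQuery : Prog :=
  .seq (.seq (.setInt 1 (.const 0) (.get 0 (.const 0))) (.seq (.setInt 1 (.const 1) (.get 0 (.const 1)))
      (.seq (.setInt 1 (.const 2) (.get 0 (.const 3))) (.setInt 1 (.const 3) (.get 0 (.const 4))))))
    (forLoop 20 0 1 (.seq (.setInt 3 (ivar 20) (.get 2 (ivar 20)))
      (.seq (.setInt 5 (ivar 20) (.get 4 (ivar 20)))
        (.seq (.setInt 7 (ivar 20) (.get 6 (.add (ivar 24) (ivar 20))))
          (.ite (.ieq (.get 14 (ivar 20)) (.const 1)) (.setReal 1 (ivar 20) .zero)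
            (.ite (.rlt (.get 0 (ivar 20)) .zero) (.setReal 1 (ivar 20) .zero)
              (.setReal 1 (ivar 20) (.get 0 (ivar 20)))))))))

/-- Add the path found by the subroutine to the union in array `16`. -/
def addPath : Prog :=
  forLoop 20 0 1 (.ite (.ieq (.get 11 (ivar 20)) (.const 1)) (.setInt 16 (ivar 20) (.const 1)) .skip)

/-- Find a shortest path for the color in variable `18`. -/
def handleColor : Prog :=
  .seq loadQuery (.seq .call (.seq
    (.ite (.ieq (.get 9 (.const 0)) (.const 1)) addPath (.setInt 26 (.const 0) (.const 1)))
    (.setInt 24 (.const 0) (.add (ivar 24) (.get 0 (.const 1))))))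

/-- Compute the cost of the union. -/
def sumCost : Prog :=
  .seq (.setReal 2 (.const 0) .zero)
    (forLoop 20 0 1 (.ite (.ieq (.get 16 (ivar 20)) (.const 1))
      (.setReal 2 (.const 0) (.add (.get 2 (.const 0)) (.get 0 (ivar 20)))) .skip))

/-- Keep the union if it is better than the best one found before. -/
def keepBest : Prog :=
  .ite (.and (.ieq (ivar 26) (.const 0)) (.not (.and (.ieq (ivar 8) (.const 1))
      (.not (.rlt (.get 2 (.const 0)) (.get 4 (.const 0)))))))
    (.seq (forLoop 20 0 1 (.setInt 10 (ivar 20) (.get 16 (ivar 20))))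
      (.seq (.setReal 4 (.const 0) (.get 2 (.const 0))) (.setInt 8 (.const 0) (.const 1))))
    .skip

/-- Proceed to the next subset of the multi-colored arcs; variable `28` is the carry. -/
def nextSubset : Prog :=
  .seq (.setInt 28 (.const 0) (.const 1))
    (forLoop 20 0 1 (.ite (.and (.ieq (ivar 28) (.const 1)) (.ieq (.get 12 (ivar 20)) (.const 1)))
      (.ite (.ieq (.get 14 (ivar 20)) (.const 1)) (.setInt 14 (ivar 20) (.const 0))
        (.seq (.setInt 14 (ivar 20) (.const 1)) (.setInt 28 (.const 0) (.const 0)))) .skip))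

/-- Find the shortest paths and their union for the subset in array `14`. -/
def handleSubset : Prog :=
  .seq (.seq (.setInt 26 (.const 0) (.const 0)) (.setInt 24 (.const 0) (.const 0)))
    (.seq startUnion (.seq (forLoop 18 0 2 handleColor) (.seq sumCost keepBest)))

/-- The algorithm for simultaneous paths. -/
def mainProg : Prog :=
  .seq findMulticolored
    (.seq (.seq (.setInt 8 (.const 0) (.const 0)) (.setInt 28 (.const 0) (.const 0)))
      (.loop (.ieq (ivar 28) (.const 0)) (.seq handleSubset nextSubset)))

/-! ### Correctness of the building blocks of the main program -/

section Main

variable {sub : State → State → ℕ → Prop} {o : GraphKind} {I : Instance o}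

theorem Instance.EncodedIn.congr {σ σ' : State} (h : I.EncodedIn σ)
    (hi : ∀ X ∈ [0, 2, 4, 6], σ'.ints X = σ.ints X) (hr : σ'.reals 0 = σ.reals 0) :
    I.EncodedIn σ' where
  n_eq := by rw [hi 0 (by simp), h.n_eq]
  m_eq := by rw [hi 0 (by simp), h.m_eq]
  k_eq := by rw [hi 0 (by simp), h.k_eq]
  s_eq := by rw [hi 0 (by simp), h.s_eq]
  t_eq := by rw [hi 0 (by simp), h.t_eq]
  tail_eq a := by rw [hi 2 (by simp), h.tail_eq]
  head_eq a := by rw [hi 4 (by simp), h.head_eq]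
  color_eq i a := by rw [hi 6 (by simp), h.color_eq]
  cost_eq a := by rw [hr, h.cost_eq]

theorem Instance.EncodedIn.frame {p : Prog} {σ σ' : State} (h : I.EncodedIn σ) (hF : Frame p σ σ')
    (hi : ∀ X ∈ [0, 2, 4, 6], ¬ p.WritesInt X) (hr : ¬ p.WritesReal 0) : I.EncodedIn σ' :=
  h.congr (fun X hX => hF.ints X (hi X hX)) (hF.reals 0 hr)

theorem State.HoldsSet.frame {p : Prog} {σ σ' : State} {A m : ℕ} {B : Finset (Fin m)}
    (h : σ.HoldsSet A B) (hF : Frame p σ σ') (hA : ¬ p.WritesInt A) : σ'.HoldsSet A B :=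
  h.congr (hF.ints A hA)

/-- Variable `22` sums the entries of column `a` of the color table, which is the number of classes
containing `a`. As the machine cannot multiply, the address `j * I.m + a` is kept in variable `24`
and advanced by `I.m`. -/
theorem countColors_ensures (hsub : ∀ σ σ' t, sub σ σ' t → SameEvenArrays σ σ') {σ : State}
    {l : List (State × ℕ)} (h : I.EncodedIn σ) {a : Fin I.m} (h22 : σ.ints 22 0 = 0)
    (h24 : σ.ints 24 0 = a) :
    Ensures sub countColors σ l (I.k * 4 + 2) fun σ' l' => l' = l ∧
      (1 < σ'.ints 22 0 ↔ a ∈ I.multicolored) := by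
  refine Ensures.forLoop hsub (fun j σ' l' => l' = l ∧ σ'.ints 24 0 = j * I.m + a ∧
      σ'.ints 22 0 = ∑ i ∈ Finset.range j, σ.ints 6 (i * I.m + a)) h.k_eq (by decide) (by decide)
    (by decide) (by simp [h22, h24]) ?_ ?_
  · rintro j hj σ₁ l₁ hF - ⟨rfl, h24', h22'⟩
    have h₁ := h.frame hF (by decide) (by decide)
    have h6 : σ₁.ints 6 = σ.ints 6 := hF.ints 6 (by decide)
    refine (Ensures.of_wp (Q := fun σ' => σ'.ints 24 0 = (j + 1) * I.m + a ∧
      σ'.ints 22 0 = ∑ i ∈ Finset.range (j + 1), σ.ints 6 (i * I.m + a)) ?_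
      (by simp [Prog.length])).consequence hsub le_rfl ?_
    · simp [Prog.wp, IExp.eval, h24', h22', h6, h₁.m_eq, Finset.sum_range_succ]
      ring
    · rintro σ' l' - ⟨rfl, h'⟩ -
      simpa using h'
  · rintro σ' l' - ⟨rfl, -, h22'⟩
    refine ⟨rfl, ?_⟩
    rw [h22', Finset.sum_range, Finset.sum_congr rfl fun i _ => h.color_eq i a]
    simp only [Finset.sum_boole, Nat.cast_id, Finset.one_lt_card, Instance.multicolored,
      Finset.mem_filter, Finset.mem_univ, true_and]
    constructor
    · rintro ⟨i, hi, j, hj, hij⟩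
      exact ⟨i, j, hij, hi, hj⟩
    · rintro ⟨i, j, hij, hi, hj⟩
      exact ⟨i, hi, j, hj, hij⟩

theorem findMulticolored_ensures (hsub : ∀ σ σ' t, sub σ σ' t → SameEvenArrays σ σ') {σ : State}
    {l : List (State × ℕ)} (h : I.EncodedIn σ) :
    Ensures sub findMulticolored σ l (I.m * (I.k * 4 + 10) + 2) fun σ' l' => l' = l ∧
      σ'.HoldsSet 12 I.multicolored ∧ σ'.HoldsSet 14 (∅ : Finset (Fin I.m)) := by
  refine Ensures.forLoop (Tb := I.k * 4 + 8) hsub (fun j σ' l' => l' = l ∧ ∀ a : Fin I.m, a.val < j →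
      σ'.ints 12 a = (if a ∈ I.multicolored then 1 else 0) ∧ σ'.ints 14 a = 0) h.m_eq (by decide)
    (by decide) (by decide) (by simp) ?_ ?_
  · rintro j hj σ₁ l₁ hF h18 ⟨rfl, ha⟩
    have h₁ := h.frame hF (by decide) (by decide)
    refine (Ensures.seq (T₂ := I.k * 4 + 2 + 4) (Ensures.of_wp (T := 2)
      (Q := fun σ' => σ'.ints 22 0 = 0 ∧ σ'.ints 24 0 = j)
      (by simp [Prog.wp, IExp.eval, h18]) (by simp [Prog.length])) hsub ?_).le (by omega)
    rintro σ₂ _ hF₂ ⟨rfl, h22, h24⟩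
    have h₂ := h₁.frame hF₂ (by decide) (by decide)
    refine (countColors_ensures hsub h₂ (a := ⟨j, hj⟩) h22 h24).seq hsub ?_
    rintro σ₃ _ hF₃ ⟨rfl, h22'⟩
    have h18' : σ₃.ints 18 0 = j := by
      rw [hF₃.ints 18 (by decide), hF₂.ints 18 (by decide), h18]
    have h12 : σ₃.ints 12 = σ₁.ints 12 := by
      rw [hF₃.ints 12 (by decide), hF₂.ints 12 (by decide)]
    have h14 : σ₃.ints 14 = σ₁.ints 14 := by
      rw [hF₃.ints 14 (by decide), hF₂.ints 14 (by decide)]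
    refine (Ensures.of_wp (T := 4) (Q := fun σ' => ∀ a : Fin I.m, a.val < j + 1 →
      σ'.ints 12 a = (if a ∈ I.multicolored then 1 else 0) ∧ σ'.ints 14 a = 0) ?_
      (by simp [Prog.length])).consequence hsub le_rfl ?_
    · simp only [Prog.wp, BExp.Holds, IExp.eval, h22', h18']
      refine ⟨fun hm a ha' => ?_, fun hm a ha' => ?_⟩
      all_goals
        rcases Nat.lt_succ_iff_lt_or_eq.1 ha' with ha' | ha'
        · simp [ha'.ne, h12, h14, ha a ha']
        · obtain rfl : a = ⟨j, hj⟩ := Fin.ext ha'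
          simp [hm, h18']
    · rintro σ' l' - ⟨rfl, h'⟩ -
      exact ⟨rfl, by simpa using h'⟩
  · rintro σ' l' - ⟨rfl, h'⟩
    exact ⟨rfl, fun a => (h' a a.isLt).1, fun a => by simpa using (h' a a.isLt).2⟩

theorem startUnion_ensures (hsub : ∀ σ σ' t, sub σ σ' t → SameEvenArrays σ σ') {σ : State}
    {l : List (State × ℕ)} (h : I.EncodedIn σ) :
    Ensures sub startUnion σ l (I.m * 5 + 2) fun σ' l' => l' = l ∧
      σ'.HoldsSet 16 (Finset.univ.filter fun a => I.cost a < 0) := by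
  refine Ensures.forLoop hsub (fun j σ' l' => l' = l ∧ ∀ a : Fin I.m, a.val < j →
      σ'.ints 16 a = if I.cost a < 0 then 1 else 0) h.m_eq (by decide)
    (by decide) (by decide) (by simp) ?_ ?_
  · rintro j hj σ₁ l₁ hF h20 ⟨rfl, ha⟩
    have h₁ := h.frame hF (by decide) (by decide)
    have hc : σ₁.reals 0 j = I.cost ⟨j, hj⟩ := h₁.cost_eq ⟨j, hj⟩
    refine (Ensures.of_wp (T := 3) (Q := fun σ' => ∀ a : Fin I.m, a.val < j + 1 →
      σ'.ints 16 a = if I.cost a < 0 then 1 else 0) ?_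
      (by simp [Prog.length])).consequence hsub le_rfl ?_
    · simp only [Prog.wp, BExp.Holds, IExp.eval, RExp.eval, h20, hc]
      refine ⟨fun hm a ha' => ?_, fun hm a ha' => ?_⟩
      all_goals
        rcases Nat.lt_succ_iff_lt_or_eq.1 ha' with ha' | ha'
        · simp [ha'.ne, ha a ha']
        · obtain rfl : a = ⟨j, hj⟩ := Fin.ext ha'
          simp [hm]
    · rintro σ' l' - ⟨rfl, h'⟩ -
      exact ⟨rfl, by simpa using h'⟩
  · rintro σ' l' - ⟨rfl, h'⟩
    exact ⟨rfl, fun a => by simpa using h' a a.isLt⟩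

/-- The whole input is written anew for every call, because the subroutine may have destroyed the
arrays with odd names. The two tests produce the cost `0` on `S` and on negative arcs, that is, the
modified cost. -/
theorem loadQuery_ensures (hsub : ∀ σ σ' t, sub σ σ' t → SameEvenArrays σ σ') {σ : State}
    {l : List (State × ℕ)} (h : I.EncodedIn σ) {S : Finset (Fin I.m)} (hS : σ.HoldsSet 14 S)
    {i : Fin I.k} (h24 : σ.ints 24 0 = i * I.m) :
    Ensures sub loadQuery σ l (I.m * 10 + 6) fun σ' l' => l' = l ∧
      (I.query S i).EncodedIn σ' := by
  refine (Ensures.seq (T₂ := I.m * 10 + 2) (Ensures.of_wp (T := 4)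
    (Q := fun σ' => σ'.ints 1 0 = I.n ∧ σ'.ints 1 1 = I.m ∧ σ'.ints 1 2 = I.s ∧ σ'.ints 1 3 = I.t)
    (by simp [Prog.wp, IExp.eval, h.n_eq, h.m_eq, h.s_eq, h.t_eq])
    (by simp [Prog.length])) hsub ?_).le (by omega)
  rintro σ₀ l₀ hF₀ ⟨rfl, h1⟩
  replace h := h.frame hF₀ (by decide) (by decide)
  replace hS := hS.frame hF₀ (by decide)
  replace h24 : σ₀.ints 24 0 = i * I.m := by rw [hF₀.ints 24 (by decide), h24]
  refine Ensures.forLoop hsub (fun j σ' l' => l' = l₀ ∧ ∀ a : Fin I.m, a.val < j →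
      σ'.ints 3 a = I.G.tail a ∧ σ'.ints 5 a = I.G.head a ∧
      σ'.ints 7 a = (if a ∈ I.color i then 1 else 0) ∧ σ'.reals 1 a = (I.query S i).cost a)
    h.m_eq (by decide) (by decide) (by decide) (by simp) ?_ ?_
  · rintro j hj σ₁ l₁ hF h20 ⟨rfl, ha⟩
    have h₁ := h.frame hF (by decide) (by decide)
    have h2 : σ₁.ints 2 j = I.G.tail ⟨j, hj⟩ := h₁.tail_eq ⟨j, hj⟩
    have h4 : σ₁.ints 4 j = I.G.head ⟨j, hj⟩ := h₁.head_eq ⟨j, hj⟩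
    have h6 : σ₁.ints 6 (i * I.m + j) = if ⟨j, hj⟩ ∈ I.color i then 1 else 0 :=
      h₁.color_eq i ⟨j, hj⟩
    have h14 : σ₁.ints 14 j = if ⟨j, hj⟩ ∈ S then 1 else 0 := hS.frame hF (by decide) ⟨j, hj⟩
    have h24 : σ₁.ints 24 0 = i * I.m := by rw [hF.ints 24 (by decide), h24]
    have hc : σ₁.reals 0 j = I.cost ⟨j, hj⟩ := h₁.cost_eq ⟨j, hj⟩
    refine (Ensures.of_wp (T := 8) (Q := fun σ' => ∀ a : Fin I.m, a.val < j + 1 →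
      σ'.ints 3 a = I.G.tail a ∧ σ'.ints 5 a = I.G.head a ∧
      σ'.ints 7 a = (if a ∈ I.color i then 1 else 0) ∧ σ'.reals 1 a = (I.query S i).cost a) ?_
      (by simp [Prog.length])).consequence hsub le_rfl ?_
    · simp only [Prog.wp, BExp.Holds, IExp.eval, RExp.eval, h20, State.ints_setInt,
        State.reals_setInt]
      refine ⟨fun hm a ha' => ?_, fun hm => ⟨fun hm' a ha' => ?_, fun hm' a ha' => ?_⟩⟩
      all_goals
        rcases Nat.lt_succ_iff_lt_or_eq.1 ha' with ha' | ha'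
        · simpa [ha'.ne] using ha a ha'
        · obtain rfl : a = ⟨j, hj⟩ := Fin.ext ha'
          simp_all [Instance.query, le_of_lt]
    · rintro σ' l' - ⟨rfl, h'⟩ -
      exact ⟨rfl, by simpa using h'⟩
  · rintro σ' l' hF ⟨rfl, h'⟩
    obtain ⟨h10, h11, h12, h13⟩ := h1
    have hi1 : σ'.ints 1 = σ₀.ints 1 := hF.ints 1 (by decide)
    rw [← hi1] at h10 h11 h12 h13
    exact ⟨rfl, h10, h11, h12, h13, fun a => (h' a a.isLt).1, fun a => (h' a a.isLt).2.1,
      fun a => (h' a a.isLt).2.2.1, fun a => (h' a a.isLt).2.2.2⟩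

theorem addPath_ensures (hsub : ∀ σ σ' t, sub σ σ' t → SameEvenArrays σ σ') {σ : State}
    {l : List (State × ℕ)} (h : I.EncodedIn σ) {P D : Finset (Fin I.m)} (hP : σ.HoldsSet 11 P)
    (hD : σ.HoldsSet 16 D) :
    Ensures sub addPath σ l (I.m * 5 + 2) fun σ' l' => l' = l ∧ σ'.HoldsSet 16 (P ∪ D) := by
  refine Ensures.forLoop hsub (fun j σ' l' => l' = l ∧
      σ'.HoldsSet 16 ((P.filter fun a => a.val < j) ∪ D)) h.m_eq (by decide)
    (by decide) (by decide) ⟨rfl, ?_⟩ ?_ ?_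
  · simpa using hD.congr (by simp [State.setInt])
  · rintro j hj σ₁ l₁ hF h20 ⟨rfl, ha⟩
    have h11 : σ₁.ints 11 j = if ⟨j, hj⟩ ∈ P then 1 else 0 := hP.frame hF (by decide) ⟨j, hj⟩
    refine (Ensures.of_wp (T := 3) (Q := fun σ' =>
      σ'.HoldsSet 16 ((P.filter fun a => a.val < j + 1) ∪ D)) ?_
      (by simp [Prog.length])).consequence hsub le_rfl ?_
    · simp only [Prog.wp, BExp.Holds, IExp.eval, h20, h11]
      have := filter_val_lt_succ (F := P) ⟨j, hj⟩
      simp only at this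
      rw [this]
      refine ⟨fun hm => ?_, fun hm => ?_⟩
      · have hm : ⟨j, hj⟩ ∈ P := by simpa using hm
        rw [if_pos hm, Finset.insert_union]
        exact ha.insert ⟨j, hj⟩
      · have hm : ⟨j, hj⟩ ∉ P := by simpa using hm
        rwa [if_neg hm]
    · rintro σ' l' - ⟨rfl, h'⟩ -
      exact ⟨rfl, h'.congr (by simp [State.setInt])⟩
  · rintro σ' l' - ⟨rfl, h'⟩
    exact ⟨rfl, by simpa using h'⟩

theorem sumCost_ensures (hsub : ∀ σ σ' t, sub σ σ' t → SameEvenArrays σ σ') {σ : State}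
    {l : List (State × ℕ)} (h : I.EncodedIn σ) :
    Ensures sub sumCost σ l (I.m * 5 + 3) fun σ' l' => l' = l ∧
      ∀ B : Finset (Fin I.m), σ.HoldsSet 16 B → σ'.reals 2 0 = ∑ a ∈ B, I.cost a := by
  refine (Ensures.seq (T₂ := I.m * 5 + 2) (Ensures.of_wp (T := 1)
    (Q := fun σ' => σ'.reals 2 0 = 0) (by simp [Prog.wp, RExp.eval, IExp.eval])
    (by simp [Prog.length])) hsub ?_).le (by omega)
  rintro σ₀ l₀ hF₀ ⟨rfl, h2⟩
  replace h := h.frame hF₀ (by decide) (by decide)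
  have h16 : σ₀.ints 16 = σ.ints 16 := hF₀.ints 16 (by decide)
  -- The partial sum is expressed through memory contents alone; the set `B` enters only at the end.
  refine Ensures.forLoop (Tb := 3) hsub (fun j σ' l' => l' = l₀ ∧ σ'.reals 2 0 =
      ∑ a ∈ Finset.range j, if σ.ints 16 a = 1 then σ₀.reals 0 a else 0)
    h.m_eq (by decide) (by decide) (by decide) (by simp [h2]) ?_ ?_
  · rintro j hj σ₁ l₁ hF h20 ⟨rfl, ha⟩
    have h16 : σ₁.ints 16 = σ.ints 16 := by rw [hF.ints 16 (by decide), h16]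
    have h0 : σ₁.reals 0 = σ₀.reals 0 := hF.reals 0 (by decide)
    refine (Ensures.of_wp (Q := fun σ' => σ'.reals 2 0 =
      ∑ a ∈ Finset.range (j + 1), if σ.ints 16 a = 1 then σ₀.reals 0 a else 0) ?_
      (by simp [Prog.length])).consequence hsub le_rfl ?_
    · simp only [Prog.wp, BExp.Holds, IExp.eval, RExp.eval, h20, h16]
      refine ⟨fun hm => ?_, fun hm => ?_⟩
      · simp [Finset.sum_range_succ, hm, ha, h0]
      · simp [Finset.sum_range_succ, hm, ha]
    · rintro σ' l' - ⟨rfl, h'⟩ -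
      exact ⟨rfl, by simpa using h'⟩
  · rintro σ' l' - ⟨rfl, h'⟩
    refine ⟨rfl, fun B hB => ?_⟩
    rw [h', Finset.sum_range]
    have : ∀ a : Fin I.m, (if σ.ints 16 a = 1 then σ₀.reals 0 a else 0) =
        if a ∈ B then I.cost a else 0 := fun a => by simp [hB a, h.cost_eq a]
    simp [this]

/-- Binary increment: while the carry is `1`, it stands for a pending amount `weight F j`, and the
rank plus this amount is `rank F S + 1`. Erasing an element doubles the amount, inserting one
absorbs it, and arcs outside `F` leave it unchanged. -/
theorem nextSubset_ensures (hsub : ∀ σ σ' t, sub σ σ' t → SameEvenArrays σ σ') {σ : State}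
    {l : List (State × ℕ)} (h : I.EncodedIn σ) {F S : Finset (Fin I.m)} (hF : σ.HoldsSet 12 F)
    (hSF : S ⊆ F) (hS : σ.HoldsSet 14 S) :
    Ensures sub nextSubset σ l (I.m * 8 + 3) fun σ' l' => l' = l ∧ ∃ S' ⊆ F, σ'.HoldsSet 14 S' ∧
      ((σ'.ints 28 0 = 0 ∧ rank F S' = rank F S + 1) ∨
        (σ'.ints 28 0 = 1 ∧ rank F S + 1 = 2 ^ F.card)) := by
  refine (Ensures.seq (T₂ := I.m * 8 + 2) (Ensures.of_wp (T := 1)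
    (Q := fun σ' => σ'.ints 28 0 = 1) (by simp [Prog.wp, IExp.eval])
    (by simp [Prog.length])) hsub ?_).le (by omega)
  rintro σ₀ l₀ hF₀ ⟨rfl, h28⟩
  replace h := h.frame hF₀ (by decide) (by decide)
  replace hF := hF.frame hF₀ (by decide)
  replace hS := hS.frame hF₀ (by decide)
  refine Ensures.forLoop (Tb := 6) hsub (fun j σ' l' => l' = l₀ ∧ ∃ S' ⊆ F, σ'.HoldsSet 14 S' ∧
      ((σ'.ints 28 0 = 0 ∧ rank F S' = rank F S + 1) ∨
        (σ'.ints 28 0 = 1 ∧ rank F S' + weight F j = rank F S + 1)))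
    h.m_eq (by decide) (by decide) (by decide)
    ⟨rfl, S, hSF, hS.congr (by simp [State.setInt]), Or.inr ⟨by simpa using h28, by
      rw [weight_zero]⟩⟩ ?_ ?_
  · rintro j hj σ₁ l₁ hFr h20 ⟨rfl, S', hS'F, hS', hc⟩
    have h12 : σ₁.ints 12 j = if ⟨j, hj⟩ ∈ F then 1 else 0 := hF.frame hFr (by decide) ⟨j, hj⟩
    have h14 : σ₁.ints 14 j = if ⟨j, hj⟩ ∈ S' then 1 else 0 := hS' ⟨j, hj⟩
    refine (Ensures.of_wp (Q := fun σ' => ∃ S' ⊆ F, σ'.HoldsSet 14 S' ∧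
      ((σ'.ints 28 0 = 0 ∧ rank F S' = rank F S + 1) ∨
        (σ'.ints 28 0 = 1 ∧ rank F S' + weight F (j + 1) = rank F S + 1))) ?_
      (by simp [Prog.length])).consequence hsub le_rfl ?_
    · simp only [Prog.wp, BExp.Holds, IExp.eval, h20, h12, h14]
      refine ⟨?_, fun hn => ?_⟩
      · rintro ⟨h28, hm⟩
        have hm : ⟨j, hj⟩ ∈ F := by simpa using hm
        have hr : rank F S' + weight F j = rank F S + 1 := by
          rcases hc with ⟨h28', -⟩ | ⟨-, hr⟩
          · omega
          · exact hr
        have hw := weight_succ_of_mem hm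
        simp only at hw
        refine ⟨fun ha => ?_, fun ha => ?_⟩
        · have ha : ⟨j, hj⟩ ∈ S' := by simpa using ha
          refine ⟨S'.erase ⟨j, hj⟩, (Finset.erase_subset _ _).trans hS'F, fun b => ?_,
            Or.inr ⟨by simpa using h28, ?_⟩⟩
          · have := hS' b
            by_cases hb : b = ⟨j, hj⟩
            · simp [hb]
            · have : b.val ≠ j := fun h => hb (Fin.ext h)
              simp [hb, this, hS' b]
          · have := Finset.sum_erase_add S' (fun a => weight F a.val) ha
            simp only [rank] at this hr ⊢
            omega
        · have ha : ⟨j, hj⟩ ∉ S' := by simpa using ha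
          refine ⟨insert ⟨j, hj⟩ S', Finset.insert_subset hm hS'F,
            (hS'.insert ⟨j, hj⟩).congr (by simp [State.setInt]), Or.inl ⟨by simp, ?_⟩⟩
          rw [rank, Finset.sum_insert ha, ← hr, rank, add_comm]
      · refine ⟨S', hS'F, hS', hc.imp_right fun ⟨h28, hr⟩ => ⟨h28, ?_⟩⟩
        have hm : ⟨j, hj⟩ ∉ F := fun hm => hn ⟨h28, by simp [hm]⟩
        have hw := weight_succ_of_notMem hm
        simp only at hw
        rw [hw, hr]
    · rintro σ' l' - ⟨rfl, S', hS'F, hS', hc⟩ -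
      exact ⟨rfl, S', hS'F, hS'.congr (by simp [State.setInt]), by simpa using hc⟩
  · rintro σ' l' - ⟨rfl, S', hS'F, hS', hc⟩
    refine ⟨rfl, S', hS'F, hS', hc.imp_right fun ⟨h28, hr⟩ => ⟨h28, ?_⟩⟩
    rw [weight_card] at hr
    -- A carry that survives is worth `2 ^ F.card`, and `rank F S + 1` cannot exceed this, so `S`
    -- had the largest rank.
    have := rank_lt hSF
    omega

end Main

/-! ### The log of calls, the best union, and the loop over all subsets -/

section Main

variable {sub : State → State → ℕ → Prop} {o : GraphKind} {I : Instance o}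

/-- The executions of the subroutine recorded in `l` are, in some order, exactly one for each pair
in `X`. -/
def Instance.Logged (I : Instance o) (X : Finset (Fin I.m) × Fin I.k → Prop)
    (l : List (State × ℕ)) : Prop :=
  ∃ L : List (Finset (Fin I.m) × Fin I.k), L.Nodup ∧ (∀ x, x ∈ L ↔ X x) ∧
    List.Forall₂ (fun x call => (I.query x.1 x.2).EncodedIn call.1) L l

theorem Instance.Logged.congr {X Y : Finset (Fin I.m) × Fin I.k → Prop} {l : List (State × ℕ)}
    (h : I.Logged X l) (hXY : ∀ x, X x ↔ Y x) : I.Logged Y l := by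
  obtain ⟨L, h₁, h₂, h₃⟩ := h
  exact ⟨L, h₁, fun x => (h₂ x).trans (hXY x), h₃⟩

theorem Instance.Logged.concat {X : Finset (Fin I.m) × Fin I.k → Prop} {l : List (State × ℕ)}
    (h : I.Logged X l) {x : Finset (Fin I.m) × Fin I.k} (hx : ¬ X x) {σ : State} (t : ℕ)
    (hσ : (I.query x.1 x.2).EncodedIn σ) :
    I.Logged (fun y => X y ∨ y = x) (l ++ [(σ, t)]) := by
  obtain ⟨L, h₁, h₂, h₃⟩ := h
  refine ⟨L ++ [x], ?_, by simp [h₂], List.rel_append h₃ (.cons hσ .nil)⟩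
  refine List.Nodup.append h₁ (by simp) ?_
  simpa [h₂] using hx

theorem Instance.Logged.length_eq {l : List (State × ℕ)}
    (h : I.Logged (fun x => x.1 ⊆ I.multicolored) l) : l.length = I.k * 2 ^ I.ell := by
  obtain ⟨L, h₁, h₂, h₃⟩ := h
  have : L.toFinset = I.multicolored.powerset ×ˢ Finset.univ := by
    ext x
    simp [h₂]
  rw [← h₃.length_eq, ← List.toFinset_card_of_nodup h₁, this, Finset.card_product,
    Finset.card_powerset, Finset.card_univ, Fintype.card_fin, mul_comm, Instance.ell]

/-- After the first `j` colors, array `16` holds the union of their shortest paths and of the arcs of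
negative cost, unless variable `26` tells that there is no feasible set. -/
def Instance.Collected (I : Instance o) (S : Finset (Fin I.m)) (j : ℕ) (σ : State) : Prop :=
  ∃ D, σ.HoldsSet 16 D ∧ ((σ.ints 26 0 = 1 ∧ ¬ ∃ B, I.Feasible B) ∨
    (σ.ints 26 0 = 0 ∧ ∃ P : Fin I.k → Finset (Fin I.m),
      (∀ i : Fin I.k, i.val < j → (I.query S i).IsShortest o (P i)) ∧
      D = (Finset.univ.filter fun i : Fin I.k => i.val < j).biUnion P ∪
        Finset.univ.filter fun a => I.cost a < 0))

theorem handleColor_ensures (hsub : ∀ σ σ' t, sub σ σ' t → SameEvenArrays σ σ')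
    (hcall : ∀ (q : SPInstance) σ, q.EncodedIn σ → ∃ σ' t, sub σ σ' t ∧ q.SolvedIn o σ')
    {σ : State} {l : List (State × ℕ)} (h : I.EncodedIn σ) {S : Finset (Fin I.m)}
    (hS : σ.HoldsSet 14 S) {i : Fin I.k} (h24 : σ.ints 24 0 = i * I.m) (hC : I.Collected S i σ) :
    Ensures sub handleColor σ l (I.m * 15 + 11) fun σ' l' => σ'.ints 24 0 = (i + 1) * I.m ∧
      I.Collected S (i + 1) σ' ∧ ∃ τ t, l' = l ++ [(τ, t)] ∧ (I.query S i).EncodedIn τ := by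
  refine ((loadQuery_ensures hsub h hS h24).seq (T₂ := 1 + (I.m * 5 + 3 + 1)) hsub ?_).le (by omega)
  rintro σ₁ l₁ hF₁ ⟨rfl, hq⟩
  replace h := h.frame hF₁ (by decide) (by decide)
  replace h24 : σ₁.ints 24 0 = i * I.m := by rw [hF₁.ints 24 (by decide), h24]
  have h26 : σ₁.ints 26 = σ.ints 26 := hF₁.ints 26 (by decide)
  obtain ⟨D, hD, hC⟩ := hC
  rw [← h26] at hC
  replace hD := hD.frame hF₁ (by decide)
  obtain ⟨σ₂, t, hst, hsol⟩ := hcall _ _ hq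
  refine Ensures.seq (T₁ := 1) (Q₁ := fun σ' l' => σ' = σ₂ ∧ l' = l₁ ++ [(σ₁, t)])
    -- The `t` steps of the subroutine are covered by the log; only the call itself is charged.
    ⟨σ₂, t + 1, _, .call hst, by simp [add_comm], rfl, rfl⟩ hsub ?_
  rintro σ₂ _ hF₂ ⟨rfl, rfl⟩
  replace h := h.frame hF₂ (by decide) (by decide)
  replace h24 : σ₂.ints 24 0 = i * I.m := by rw [hF₂.ints 24 (by decide), h24]
  have h26 : σ₂.ints 26 = σ₁.ints 26 := hF₂.ints 26 (by decide)
  rw [← h26] at hC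
  replace hD := hD.frame hF₂ (by decide)
  refine Ensures.seq (Q₁ := fun σ' l' => l' = l₁ ++ [(σ₁, t)] ∧ I.Collected S (i + 1) σ')
    (Ensures.ite (T := I.m * 5 + 2) (fun hb => ?_) fun hb => ?_) hsub ?_
  · simp only [BExp.Holds, IExp.eval] at hb
    obtain ⟨-, (P' : Finset (Fin I.m)), hP', h11⟩ := hsol.resolve_right fun h' => by omega
    refine (addPath_ensures hsub h h11 hD).consequence hsub le_rfl ?_
    rintro σ' l' hF ⟨rfl, h16⟩
    have h26 : σ'.ints 26 = σ₂.ints 26 := hF.ints 26 (by decide)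
    refine ⟨rfl, _, h16, ?_⟩
    rw [h26]
    -- Redefining `P` at `i` keeps the paths of all earlier colors.
    refine hC.imp_right fun ⟨h26, P, hP, hDP⟩ => ⟨h26, Function.update P i P', fun j hj => ?_, ?_⟩
    · by_cases hji : j = i
      · subst hji
        simpa using hP'
      · have : j.val ≠ i.val := fun h => hji (Fin.ext h)
        simpa [hji] using hP j (by omega)
    · rw [filter_val_lt_succ, if_pos (Finset.mem_univ _), Finset.biUnion_insert, hDP,
        Function.update_self, ← Finset.union_assoc]
      congr 2
      refine Finset.biUnion_congr rfl fun j hj => ?_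
      have hji : j ≠ i := by
        rintro rfl
        simp at hj
      simp [hji]
  · simp only [BExp.Holds, IExp.eval] at hb
    obtain ⟨-, hinf⟩ := hsol.resolve_left fun h' => hb h'.1
    refine (Ensures.of_wp (T := 1) (Q := fun σ' => σ' = σ₂.setInt 26 0 1) (by
      simp [Prog.wp, IExp.eval]) (by simp [Prog.length])).consequence hsub (by omega) ?_
    rintro σ' l' - ⟨rfl, rfl⟩
    refine ⟨rfl, D, hD.congr (by simp [State.setInt]), Or.inl ⟨by simp, ?_⟩⟩
    -- Feasibility of the query does not depend on the costs: a color without a path rules out every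
    -- feasible set, whatever `S` is.
    rintro ⟨B, hB⟩
    obtain ⟨P, hP, hPB⟩ := hB i
    exact hinf ⟨P, hP, hPB.trans Finset.inter_subset_right⟩
  · rintro σ₃ _ hF₃ ⟨rfl, D', hD', hC'⟩
    replace h := h.frame hF₃ (by decide) (by decide)
    replace h24 : σ₃.ints 24 0 = i * I.m := by rw [hF₃.ints 24 (by decide), h24]
    refine (Ensures.of_wp (T := 1) (Q := fun σ' => σ' = σ₃.setInt 24 0 ((i + 1) * I.m)) (by
      simp [Prog.wp, IExp.eval, h24, h.m_eq, add_mul]) (by simp [Prog.length])).consequence hsub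
      le_rfl ?_
    rintro σ' l' - ⟨rfl, rfl⟩
    exact ⟨by simp, ⟨D', hD'.congr (by simp [State.setInt]), by simpa using hC'⟩, _, _, rfl, hq⟩

/-- Array `10` holds the best one of the unions for the sets in `𝒱`, unless there is no feasible
set. -/
def Instance.Best (I : Instance o) (𝒱 : Finset (Finset (Fin I.m))) (σ : State) : Prop :=
  (σ.ints 8 0 = 0 ∧ (𝒱 = ∅ ∨ ¬ ∃ B, I.Feasible B)) ∨
  (σ.ints 8 0 = 1 ∧ ∃ B, I.IsUnionOfShortestPaths B ∧ σ.HoldsSet 10 B ∧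
    σ.reals 4 0 = ∑ a ∈ B, I.cost a ∧
    ∀ T ∈ 𝒱, ∃ P : Fin I.k → Finset (Fin I.m), (∀ i, (I.query T i).IsShortest o (P i)) ∧
      ∑ a ∈ B, I.cost a ≤ ∑ a ∈ I.union P, I.cost a)

theorem Instance.IsUnionOfShortestPaths.feasible {B : Finset (Fin I.m)}
    (h : I.IsUnionOfShortestPaths B) : I.Feasible B := by
  obtain ⟨F, -, P, hP, rfl⟩ := h
  exact I.feasible_union hP

theorem Instance.Best.frame {𝒱 : Finset (Finset (Fin I.m))} {p : Prog} {σ σ' : State}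
    (h : I.Best 𝒱 σ) (hF : Frame p σ σ') (h8 : ¬ p.WritesInt 8) (h10 : ¬ p.WritesInt 10)
    (h4 : ¬ p.WritesReal 4) : I.Best 𝒱 σ' := by
  rw [Instance.Best, hF.ints 8 h8, hF.reals 4 h4]
  exact h.imp_right fun ⟨h₁, B, h₂, h₃, h₄⟩ => ⟨h₁, B, h₂, h₃.frame hF h10, h₄⟩

/-- A feasible `B'` is matched by the guess consisting of its multi-colored arcs. Some choice of
shortest paths per guess suffices, since the cost comparison holds for every choice. -/
theorem Instance.Best.solvedIn {σ : State} (h : I.Best I.multicolored.powerset σ) :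
    I.SolvedIn σ := by
  rcases h with ⟨h8, h | h⟩ | ⟨h8, B, hB, h10, -, hbest⟩
  · exact absurd h (Finset.powerset_nonempty _).ne_empty
  · exact Or.inr ⟨h8, h⟩
  · refine Or.inl ⟨h8, B, ⟨hB.feasible, fun B' hB' => ?_⟩, hB, h10⟩
    obtain ⟨P, hP, hle⟩ := hbest _ (Finset.mem_powerset.2 (Finset.inter_subset_left (s₂ := B')))
    exact hle.trans (Instance.sum_union_le hB' hP)

theorem keepBest_ensures (hsub : ∀ σ σ' t, sub σ σ' t → SameEvenArrays σ σ') {σ : State}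
    {l : List (State × ℕ)} (h : I.EncodedIn σ) {S : Finset (Fin I.m)} (hS : S ⊆ I.multicolored)
    {D : Finset (Fin I.m)} (hD : σ.HoldsSet 16 D) (hc : σ.reals 2 0 = ∑ a ∈ D, I.cost a)
    (hC : (σ.ints 26 0 = 1 ∧ ¬ ∃ B, I.Feasible B) ∨
      (σ.ints 26 0 = 0 ∧ ∃ P : Fin I.k → Finset (Fin I.m),
        (∀ i, (I.query S i).IsShortest o (P i)) ∧ D = I.union P))
    {𝒱 : Finset (Finset (Fin I.m))} (hbest : I.Best 𝒱 σ) :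
    Ensures sub keepBest σ l (I.m * 3 + 5) fun σ' l' => l' = l ∧ I.Best (insert S 𝒱) σ' := by
  refine Ensures.ite (T := I.m * 3 + 2 + 2) (fun hb => ?_) (fun hb => ?_)
  · simp only [BExp.Holds, IExp.eval, RExp.eval] at hb
    obtain ⟨-, P, hP, rfl⟩ := hC.resolve_left fun h' => by omega
    refine Ensures.seq (Q₁ := fun σ' l' => l' = l ∧ ∀ a : Fin I.m, σ'.ints 10 a = σ.ints 16 a)
      (Ensures.forLoop (Tb := 1) hsub (fun j σ' l' => l' = l ∧ ∀ a : Fin I.m, a.val < j →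
        σ'.ints 10 a = σ.ints 16 a) h.m_eq (by decide) (by decide) (by decide) (by simp) ?_ ?_)
      hsub ?_
    · rintro j hj σ₁ l₁ hF h20 ⟨rfl, ha⟩
      have h16 : σ₁.ints 16 = σ.ints 16 := hF.ints 16 (by decide)
      refine (Ensures.of_wp (Q := fun σ' => ∀ a : Fin I.m, a.val < j + 1 →
        σ'.ints 10 a = σ.ints 16 a) ?_ (by simp [Prog.length])).consequence hsub le_rfl ?_
      · simp only [Prog.wp, IExp.eval, h20, h16]
        intro a ha'
        rcases Nat.lt_succ_iff_lt_or_eq.1 ha' with ha' | ha'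
        · simp [ha'.ne, ha a ha']
        · simp [ha']
      · rintro σ' l' - ⟨rfl, h'⟩ -
        exact ⟨rfl, by simpa using h'⟩
    · rintro σ' l' - ⟨rfl, h'⟩
      exact ⟨rfl, fun a => h' a a.isLt⟩
    · rintro σ₁ _ hF ⟨rfl, h10⟩
      refine .of_wp ?_ (by simp [Prog.length])
      simp only [Prog.wp, IExp.eval, RExp.eval, hF.reals 2 (by decide), hc]
      refine Or.inr ⟨by simp, _, ⟨S, hS, P, hP, rfl⟩, ?_, by simp [Instance.union], ?_⟩
      · exact State.HoldsSet.congr (σ := σ₁) (fun a => (h10 a).trans (hD a))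
          (by simp [State.setInt, State.setReal])
      · intro T hT
        rcases Finset.mem_insert.1 hT with rfl | hT
        · exact ⟨P, hP, le_rfl⟩
        · rcases hbest with ⟨-, rfl | h'⟩ | ⟨h8, B, -, -, h4, hB⟩
          · simp at hT
          · exact absurd ⟨_, I.feasible_union hP⟩ h'
          · obtain ⟨P', hP', hle⟩ := hB T hT
            refine ⟨P', hP', le_trans ?_ hle⟩
            rw [← h4]
            have : σ.reals 2 0 < σ.reals 4 0 := by
              by_contra hlt
              exact hb.2 ⟨h8, hlt⟩
            exact (hc ▸ this).le
  · refine (Ensures.of_wp (T := 1) (Q := fun σ' => I.Best (insert S 𝒱) σ') ?_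
      (by simp [Prog.length])).le (by omega)
    simp only [BExp.Holds, IExp.eval, RExp.eval] at hb
    simp only [Prog.wp]
    rcases hbest with ⟨h8, h'⟩ | ⟨h8, B, hBu, h10, h4, hB⟩
    · refine Or.inl ⟨h8, Or.inr ?_⟩
      rcases hC with ⟨-, hinf⟩ | ⟨h26, -⟩
      · exact hinf
      · exact absurd ⟨h26, fun h' => by omega⟩ hb
    · rcases hC with ⟨-, hinf⟩ | ⟨h26, P, hP, rfl⟩
      · exact absurd ⟨B, hBu.feasible⟩ hinf
      · refine Or.inr ⟨h8, B, hBu, h10, h4, fun T hT => ?_⟩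
        rcases Finset.mem_insert.1 hT with rfl | hT
        · refine ⟨P, hP, ?_⟩
          rw [← h4, ← hc]
          by_contra hlt
          exact hb ⟨h26, fun h' => h'.2 (not_le.1 hlt)⟩
        · exact hB T hT

theorem handleSubset_ensures (hsub : ∀ σ σ' t, sub σ σ' t → SameEvenArrays σ σ')
    (hcall : ∀ (q : SPInstance) σ, q.EncodedIn σ → ∃ σ' t, sub σ σ' t ∧ q.SolvedIn o σ')
    {σ : State} {l : List (State × ℕ)} (h : I.EncodedIn σ) {S : Finset (Fin I.m)}
    (hSF : S ⊆ I.multicolored) (hS : σ.HoldsSet 14 S) {𝒱 : Finset (Finset (Fin I.m))}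
    (hS𝒱 : S ∉ 𝒱) (hbest : I.Best 𝒱 σ) (hlog : I.Logged (fun x => x.1 ∈ 𝒱) l) :
    Ensures sub handleSubset σ l (I.k * (I.m * 15 + 13) + I.m * 13 + 14) fun σ' l' =>
      I.Best (insert S 𝒱) σ' ∧ I.Logged (fun x => x.1 ∈ insert S 𝒱) l' := by
  refine (Ensures.seq (T₂ := I.m * 5 + 2 + (I.k * (I.m * 15 + 13) + 2 + (I.m * 5 + 3 +
    (I.m * 3 + 5)))) (Ensures.of_wp (T := 2)
    (Q := fun σ' => σ'.ints 26 0 = 0 ∧ σ'.ints 24 0 = 0) (by simp [Prog.wp, IExp.eval])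
    (by simp [Prog.length])) hsub ?_).le (by omega)
  rintro σ₁ _ hF₁ ⟨rfl, h26, h24⟩
  replace h := h.frame hF₁ (by decide) (by decide)
  replace hS := hS.frame hF₁ (by decide)
  replace hbest := hbest.frame hF₁ (by decide) (by decide) (by decide)
  refine (startUnion_ensures hsub h).seq hsub ?_
  rintro σ₂ l₂ hF₂ ⟨rfl, h16⟩
  replace h := h.frame hF₂ (by decide) (by decide)
  replace hS := hS.frame hF₂ (by decide)
  replace hbest := hbest.frame hF₂ (by decide) (by decide) (by decide)
  rw [← hF₂.ints 26 (by decide)] at h26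
  rw [← hF₂.ints 24 (by decide)] at h24
  -- The log covers all pairs with a subset in `𝒱` and those of `S` with a color below `j`; as `S ∉
  -- 𝒱`, the pair added in each round is new.
  refine Ensures.seq (Q₁ := fun σ' l' => I.Collected S I.k σ' ∧
      I.Logged (fun x => x.1 ∈ insert S 𝒱) l') (Ensures.forLoop (Tb := I.m * 15 + 11) hsub
    (fun j σ' l' => σ'.ints 24 0 = j * I.m ∧ I.Collected S j σ' ∧
      I.Logged (fun x => x.1 ∈ 𝒱 ∨ (x.1 = S ∧ x.2.val < j)) l') h.k_eq (by decide) (by decide)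
      (by decide) ⟨by simpa using h24, ?_, by simpa using hlog⟩ ?_ ?_) hsub ?_
  · exact ⟨_, h16.congr (by simp [State.setInt]), Or.inr ⟨by simpa using h26, fun _ => ∅, by simp,
      by simp⟩⟩
  · rintro j hj σ₃ l₃ hF₃ h18 ⟨h24, hC, hlog⟩
    refine (handleColor_ensures hsub hcall (i := ⟨j, hj⟩) (h.frame hF₃ (by decide) (by decide))
      (hS.frame hF₃ (by decide)) h24 hC).consequence hsub le_rfl ?_
    rintro σ' l' - ⟨h24', ⟨D, hD, hC'⟩, τ, t, rfl, hq⟩ -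
    refine ⟨by simpa using h24', ⟨D, hD.congr (by simp [State.setInt]), by simpa using hC'⟩, ?_⟩
    refine (hlog.concat (x := (S, ⟨j, hj⟩)) (by simp [hS𝒱]) t hq).congr fun x => ?_
    rw [Prod.ext_iff, Fin.ext_iff, Nat.lt_succ_iff_lt_or_eq]
    tauto
  · rintro σ' l' - ⟨-, hC, hlog⟩
    refine ⟨hC, hlog.congr fun x => ?_⟩
    simp [or_comm]
  rintro σ₃ l₃ hF₃ ⟨⟨D, hD, hC⟩, hlog⟩
  replace h := h.frame hF₃ (by decide) (by decide)
  replace hbest := hbest.frame hF₃ (by decide) (by decide) (by decide)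
  refine (sumCost_ensures hsub h).seq hsub ?_
  rintro σ₄ l₄ hF₄ ⟨rfl, h2⟩
  replace h := h.frame hF₄ (by decide) (by decide)
  replace hbest := hbest.frame hF₄ (by decide) (by decide) (by decide)
  refine (keepBest_ensures hsub h hSF (hD.frame hF₄ (by decide)) (h2 D hD) ?_ hbest).consequence
    hsub le_rfl ?_
  · rw [hF₄.ints 26 (by decide)]
    refine hC.imp_right fun ⟨h26, P, hP, hDP⟩ => ⟨h26, P, fun i => hP i i.isLt, ?_⟩
    simpa [Instance.union] using hDP
  · rintro σ' l' - ⟨rfl, h'⟩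
    exact ⟨h', hlog⟩

theorem mainProg_ensures (hsub : ∀ σ σ' t, sub σ σ' t → SameEvenArrays σ σ')
    (hcall : ∀ (q : SPInstance) σ, q.EncodedIn σ → ∃ σ' t, sub σ σ' t ∧ q.SolvedIn o σ')
    {σ : State} (h : I.EncodedIn σ) :
    Ensures sub mainProg σ [] (2 ^ I.ell * (60 * (I.size + 1) ^ 2)) fun σ' l' =>
      I.SolvedIn σ' ∧ I.Logged (fun x => x.1 ⊆ I.multicolored) l' := by
  set TR := I.k * (I.m * 15 + 13) + I.m * 13 + 14 + (I.m * 8 + 3) with hTR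
  refine ((findMulticolored_ensures hsub h).seq (T₂ := 2 + (2 ^ I.ell * (TR + 1) + 1))
    hsub ?_).le ?_
  · rintro σ₁ _ hF₁ ⟨rfl, h12, h14⟩
    replace h := h.frame hF₁ (by decide) (by decide)
    refine (Ensures.of_wp (T := 2) (Q := fun σ' => σ'.ints 8 0 = 0 ∧ σ'.ints 28 0 = 0)
      (by simp [Prog.wp, IExp.eval]) (by simp [Prog.length])).seq hsub ?_
    rintro σ₂ l₂ hF₂ ⟨rfl, h8, h28⟩
    replace h := h.frame hF₂ (by decide) (by decide)
    replace h12 := h12.frame hF₂ (by decide)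
    replace h14 := h14.frame hF₂ (by decide)
    -- The treated subsets `𝒱` have ranks below `𝒱.card`, and the next subset has exactly this rank,
    -- so it is new. The index `r` is the number of subsets left; the carry is set only when it is
    -- `0`.
    refine Ensures.loop (fun r σ' l' => I.EncodedIn σ' ∧ σ'.HoldsSet 12 I.multicolored ∧
      ∃ 𝒱 : Finset (Finset (Fin I.m)), I.Best 𝒱 σ' ∧ I.Logged (fun x => x.1 ∈ 𝒱) l' ∧
        (∀ T ∈ 𝒱, T ⊆ I.multicolored ∧ rank I.multicolored T < 𝒱.card) ∧
        𝒱.card + r = 2 ^ I.ell ∧ ((σ'.ints 28 0 = 0 ∧ ∃ S ⊆ I.multicolored, σ'.HoldsSet 14 S ∧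
          rank I.multicolored S = 𝒱.card) ∨ (σ'.ints 28 0 = 1 ∧ r = 0)))
      (2 ^ I.ell) σ₂ _ ⟨h, h12, ∅, Or.inl ⟨h8, Or.inl rfl⟩, ⟨[], by simp⟩, by simp, by simp,
        Or.inl ⟨h28, ∅, by simp, h14, by simp [rank]⟩⟩ ?_ ?_
    · rintro r σ₃ l₃ ⟨h, h12, 𝒱, hbest, hlog, h𝒱, hr, hd⟩ hb
      simp only [BExp.Holds, IExp.eval] at hb
      obtain ⟨-, S, hSF, hS, hrank⟩ := hd.resolve_right fun h' => by omega
      have hS𝒱 : S ∉ 𝒱 := fun hmem => by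
        have := (h𝒱 S hmem).2
        omega
      have hlt := rank_lt hSF
      rw [Instance.ell] at hr
      refine ⟨r - 1, by omega, (handleSubset_ensures hsub hcall h hSF hS hS𝒱 hbest hlog).seq
        hsub ?_⟩
      rintro σ₄ l₄ hF₄ ⟨hbest, hlog⟩
      replace h := h.frame hF₄ (by decide) (by decide)
      replace h12 := h12.frame hF₄ (by decide)
      replace hS := hS.frame hF₄ (by decide)
      refine (nextSubset_ensures hsub h h12 hSF hS).consequence hsub le_rfl ?_
      rintro σ₅ l₅ hF₅ ⟨rfl, S', hS'F, hS', hd⟩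
      have hcard := Finset.card_insert_of_notMem hS𝒱
      refine ⟨h.frame hF₅ (by decide) (by decide), h12.frame hF₅ (by decide), insert S 𝒱,
        hbest.frame hF₅ (by decide) (by decide) (by decide), hlog, ?_, ?_, ?_⟩
      · intro T hT
        rcases Finset.mem_insert.1 hT with rfl | hT
        · exact ⟨hSF, by omega⟩
        · exact ⟨(h𝒱 T hT).1, by have := (h𝒱 T hT).2; omega⟩
      · rw [Instance.ell]
        omega
      · rcases hd with ⟨h28, hrank'⟩ | ⟨h28, hrank'⟩
        · exact Or.inl ⟨h28, S', hS'F, hS', by omega⟩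
        · exact Or.inr ⟨h28, by omega⟩
    · rintro r σ₃ l₃ ⟨h, h12, 𝒱, hbest, hlog, h𝒱, hr, hd⟩ hb
      simp only [BExp.Holds, IExp.eval] at hb
      obtain ⟨-, rfl⟩ := hd.resolve_left fun h' => hb h'.1
      -- A family of `2 ^ I.ell` subsets of the multi-colored arcs contains all of them.
      obtain rfl : 𝒱 = I.multicolored.powerset := by
        refine Finset.eq_of_subset_of_card_le
          (fun T hT => Finset.mem_powerset.2 (h𝒱 T hT).1) ?_
        rw [Finset.card_powerset, ← Instance.ell]
        omega
      exact ⟨hbest.solvedIn, hlog.congr fun x => Finset.mem_powerset⟩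
  · have hpos : 1 ≤ 2 ^ I.ell := Nat.one_le_two_pow
    have h₁ : I.m * (I.k * 4 + 10) + 2 + 2 + 1 + (TR + 1) ≤ 60 * (I.size + 1) ^ 2 := by
      rw [hTR, Instance.size]
      ring_nf
      nlinarith
    have h₂ : I.m * (I.k * 4 + 10) + 2 + 2 + 1 ≤
        2 ^ I.ell * (I.m * (I.k * 4 + 10) + 2 + 2 + 1) := Nat.le_mul_of_pos_left _ hpos
    refine le_trans ?_ (Nat.mul_le_mul_left _ h₁)
    rw [Nat.mul_add _ _ (TR + 1)]
    omega

end Main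

/-! ### The theorem -/

theorem mainProg_runsWith {o : GraphKind} {S : Prog} (hS : IsShortestPathAlgorithm o S)
    {I : Instance o} {σ : State} (h : I.EncodedIn σ) :
    ∃ (σ' : State) (t : ℕ) (calls : List (State × ℕ)),
      RunsWith S mainProg σ σ' t calls ∧ I.SolvedIn σ' ∧
      calls.length = I.k * 2 ^ I.ell ∧ I.CallsAreQueries calls ∧
      t ≤ 2 ^ I.ell * (60 * (Polynomial.X + 1) ^ 2 : Polynomial ℕ).eval I.size +
        (calls.map Prod.snd).sum := by
  -- Restricting the subroutine to runs that obey the calling convention makes frames available;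
  -- afterwards `Exec.mono` forgets the restriction.
  obtain ⟨σ', t, c, he, ht, hs, hl⟩ := mainProg_ensures
    (sub := fun σ σ' t => Runs S σ σ' t ∧ SameEvenArrays σ σ') (fun _ _ _ h => h.2)
    (fun q σ hq => by
      obtain ⟨σ', t, h₁, h₂, h₃⟩ := hS q σ hq
      exact ⟨σ', t, ⟨h₁, h₃⟩, h₂⟩) h
  exact ⟨σ', t, c, he.mono fun _ _ _ h => h.1, hs, hl.length_eq, hl, by simpa using ht⟩

theorem polynomial_eval_nat_mono (p : Polynomial ℕ) {a b : ℕ} (h : a ≤ b) :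
    p.eval a ≤ p.eval b := by
  rw [Polynomial.eval_eq_sum, Polynomial.eval_eq_sum]
  exact Finset.sum_le_sum fun i _ => Nat.mul_le_mul_left _ (Nat.pow_le_pow_left h i)

theorem computable_two_pow : Computable fun n : ℕ => 2 ^ n := by
  have h : Primrec fun n : ℕ => Nat.rec (motive := fun _ => ℕ) 1 (fun _ x => 2 * x) n :=
    Primrec.nat_rec₁ 1 (Primrec.nat_mul.comp (Primrec.const 2) Primrec.snd)
  refine (h.of_eq fun n => ?_).to_comp
  induction n with
  | zero => rfl
  | succ n ih => rw [pow_succ, mul_comm, ← ih]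

/-- There are `I.k * 2 ^ I.ell` calls, each taking at most `p.eval I.size` steps, and `I.k ≤
I.size`; this explains the summand `Polynomial.X * p`, with f(ℓ) = 2^ℓ. -/
theorem mainProg_isFPTAlgorithm {o : GraphKind} {S : Prog} (hS : IsShortestPathAlgorithm o S)
    (hT : IsPolynomialTime S) : IsFPTAlgorithm o S mainProg := by
  obtain ⟨p, hp⟩ := hT
  refine ⟨fun n => 2 ^ n, 60 * (Polynomial.X + 1) ^ 2 + Polynomial.X * p, computable_two_pow,
    fun I σ h => ?_⟩
  obtain ⟨σ', t, calls, hr, hs, hlen, ⟨L, -, -, hL⟩, ht⟩ := mainProg_runsWith hS h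
  refine ⟨σ', t, calls, hr, hs, ?_⟩
  have hcall : ∀ x ∈ calls, x.2 ≤ p.eval I.size := by
    intro x hx
    obtain ⟨τ, hτ⟩ := hr.exists_of_mem_calls x hx
    obtain ⟨i, hi, rfl⟩ := List.getElem_of_mem hx
    have hi' : i < L.length := by rwa [hL.length_eq]
    have hq := hL.get hi' hi
    obtain ⟨τ', u, hu, hle⟩ := hp _ _ hq
    rw [(hτ.deterministic hu).2]
    -- The bound for a query is in the numbers of vertices and arcs, which together are at most the
    -- input size.
    exact hle.trans (polynomial_eval_nat_mono p (Nat.le_add_right _ _))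
  have hsum : (calls.map Prod.snd).sum ≤ calls.length * p.eval I.size := by
    have := List.sum_le_card_nsmul (calls.map Prod.snd) (p.eval I.size) (by
      intro y hy
      obtain ⟨x, hx, rfl⟩ := List.mem_map.1 hy
      exact hcall x hx)
    simpa using this
  rw [hlen] at hsum
  have hk : I.k * 2 ^ I.ell * p.eval I.size ≤ 2 ^ I.ell * (I.size * p.eval I.size) := by
    rw [mul_comm I.k, mul_assoc]
    exact Nat.mul_le_mul_left _ (Nat.mul_le_mul_right _ (Nat.le_add_left _ _))
  change t ≤ 2 ^ I.ell * _
  rw [Polynomial.eval_add, Polynomial.eval_mul (p := Polynomial.X), Polynomial.eval_X, Nat.mul_add]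
  omega

end SimPaths

theorem mainTheorem7 (o : GraphKind) :
    ∃ P : Prog,
      (∃ p : Polynomial ℕ, ∀ S : Prog, IsShortestPathAlgorithm o S →
        ∀ (I : Instance o) (σ : State), I.EncodedIn σ →
          ∃ (σ' : State) (t : ℕ) (calls : List (State × ℕ)),
            RunsWith S P σ σ' t calls ∧ I.SolvedIn σ' ∧
            calls.length = I.k * 2 ^ I.ell ∧ I.CallsAreQueries calls ∧
            t ≤ 2 ^ I.ell * p.eval I.size + (calls.map Prod.snd).sum) ∧
      ∃ S : Prog, IsShortestPathAlgorithm o S ∧ IsPolynomialTime S ∧ IsFPTAlgorithm o S P := by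
  refine ⟨mainProg, ⟨_, fun S hS I σ h => mainProg_runsWith hS h⟩, spProg o,
    isShortestPathAlgorithm_spProg o, isPolynomialTime_spProg o,
    mainProg_isFPTAlgorithm (isShortestPathAlgorithm_spProg o) (isPolynomialTime_spProg o)⟩
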